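/- Let $G=(V,E)$ be a finite simple graph and $S\subseteq V$. A rooted tree decomposition of $G$ is a tree decomposition $\mathcal T=(T,\{X_t\}_{t\in V(T)})$ with $T$ a finite rooted tree; its width is $\max_t|X_t|-1$, and a bag is \emph{full} if its size equals the width of $\mathcal T$ plus one. For a node $t$ let $V_t$ be the union of the bags of the nodes in the subtree of $T$ rooted at $t$, and put $L_t=V_t\setminus X_t$, $R_t=V\setminus V_t$. The \emph{$S$-trace} of $t$ is $(L_t^S,X_t^S,R_t^S)=(L_t\cap S,X_t\cap S,R_t\cap S)$. The nodes with a given $S$-trace with non-empty first component form a directed path; its lowest node is called an \emph{$S$-bottom node}. A child $t'$ of $t$ is an \emph{$S$-child} of $t$ if $(L_{t'}^S\cup X_{t'}^S)\setminus(R_t^S\cup X_t^S)\neq\emptyset$. The decomposition $\mathcal T$ is \emph{$S$-nice} if, for every node $t$ with parent $t'$, one of $X_t,X_{t'}$ contains the other and $\bigl||X_t|-|X_{t'}|\bigr|\le 1$, and if every $S$-bottom node $t$ satisfies one of the following: (introduce) $t$ has exactly one $S$-child $t_1$, and $X_t^S=X_{t_1}^S\cup\{v\}$ for some $v\in S\setminus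 X_{t_1}$; (forget) $t$ has exactly one $S$-child $t_1$, and $X_t^S=X_{t_1}^S\setminus\{v\}$ for some $v\in S\cap X_{t_1}$; (join) $t$ has exactly two $S$-children $t_1,t_2$, and $X_{t_1}^S\cup X_{t_2}^S\subseteq X_t^S$. A \emph{full join tree} of $\mathcal T$ is an inclusion-maximal subtree of $T$ with at least two nodes all of whose nodes have one and the same full bag. Let $T'$ be a full join tree with common bag $X$ and root $t_r$. The \emph{parts} of $T'$ are indexed by the following nodes: the $S$-children $s\notin V(T')$ of nodes of $T'$, with part $V_s$; and the parent of $t_r$, if it exists, with part $V\setminus V_{t_r}$. An $S$-nice $\mathcal T$ is \emph{slim} if: 1. the root is not an $S$-bottom node; 2. every $S$-bottom node $t$ with two $S$-children lies in a full join tree, or both $S$-children and the parent of $t$ have bags that are not full and not larger than $X_t$; 3. if the bag of an $S$-bottom node $t$ is not full, then its parent $t'$ satisfies $X_{t'}=X_t$, and $t$ is the only $S$-child of $t'$; 4. if an $S$-bottom node $t$ is of type forget and the bag of its $S$-child $t'$ is not full, then $t'$ has at most one $S$-child $t''$, and $X_{t'}=X_{t''}$ if $t''$ exists; 5. if the bag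 of the parent $t'$ of an $S$-bottom node is not full, then $t'$ is the root or the parent of $t'$ is not an $S$-bottom node; 6. every node of every full join tree is an $S$-bottom node with two $S$-children; 7. for every full join tree $T'$ with common bag $X$ and every $v\in X\setminus S$ there are three distinct neighbors $u_1,u_2,u_3\in N(v)\setminus X$ and three distinct nodes $t_1,t_2,t_3$ indexing parts of $T'$ such that, for each $i$, $u_i$ lies in the part of $t_i$ and is connected in $G-X$ to a vertex of $S$ (possibly itself). **Lemma.** If $G$ has an $S$-nice tree decomposition of width $k$, then $G$ has a slim $S$-nice tree decomposition $\mathcal T'$ of width at most $k$. In particular, for every full join tree of $\mathcal T'$ with common bag $X$ and every $v\in X\setminus S$, there are three distinct connected components of $G-X$, each containing a vertex of $S$ and a neighbor of $v$, that lie in the parts of three distinct nodes. -/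

import Mathlib

/-- A rooted tree decomposition of the graph `G` with node set `ι`. -/
structure RootedTreeDecomposition {V : Type*} (G : SimpleGraph V) (ι : Type*) where
  /-- The underlying tree on the nodes. -/
  tree : SimpleGraph ι
  isTree : tree.IsTree
  /-- The root node. -/
  root : ι
  /-- The bag of a node. -/
  bag : ι → Set V
  iUnion_bag : (⋃ t, bag t) = Set.univ
  exists_bag_of_adj : ∀ u v : V, G.Adj u v → ∃ t, u ∈ bag t ∧ v ∈ bag t
  /-- The nodes whose bag contains `v` induce a subtree: an induced subgraph of a tree is a tree
  exactly when it is connected. -/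
  connected_bag : ∀ v : V, (tree.induce {t | v ∈ bag t}).Connected

namespace RootedTreeDecomposition

variable {V ι : Type*} {G : SimpleGraph V}

/-- The width: maximum bag size minus one (an integer, equal to `-1` for the empty graph). -/
noncomputable def width (T : RootedTreeDecomposition G ι) : ℤ :=
  ((⨆ t, (T.bag t).ncard : ℕ) : ℤ) - 1

/-- The bag of `t` is full: its size is the width plus one. -/
def IsFull (T : RootedTreeDecomposition G ι) (t : ι) : Prop :=
  ((T.bag t).ncard : ℤ) = T.width + 1

/-- `p` is the parent of `c`. -/
def IsParent (T : RootedTreeDecomposition G ι) (p c : ι) : Prop :=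
  T.tree.Adj p c ∧ T.tree.dist T.root p < T.tree.dist T.root c

/-- `s` is a node of the subtree `T_t` rooted at `t`: there is a directed path, possibly of
length zero, from `t` to `s`. -/
def InSubtree (T : RootedTreeDecomposition G ι) (t s : ι) : Prop :=
  Relation.ReflTransGen T.IsParent t s

/-- `V_t`: the union of all bags in the subtree rooted at `t`. -/
def subtreeVerts (T : RootedTreeDecomposition G ι) (t : ι) : Set V :=
  {v | ∃ s, T.InSubtree t s ∧ v ∈ T.bag s}

/-- `L_t ∩ S`, where `L_t = V_t \ X_t` is the set of vertices below `t`. -/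
def traceL (T : RootedTreeDecomposition G ι) (S : Set V) (t : ι) : Set V :=
  (T.subtreeVerts t \ T.bag t) ∩ S

/-- `X_t ∩ S`. -/
def traceX (T : RootedTreeDecomposition G ι) (S : Set V) (t : ι) : Set V :=
  T.bag t ∩ S

/-- `R_t ∩ S`, where `R_t = V \ V_t` is the set of remaining vertices. -/
def traceR (T : RootedTreeDecomposition G ι) (S : Set V) (t : ι) : Set V :=
  (T.subtreeVerts t)ᶜ ∩ S

/-- The `S`-trace of a node. -/
def trace (T : RootedTreeDecomposition G ι) (S : Set V) (t : ι) : Set V × Set V × Set V :=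
  (T.traceL S t, T.traceX S t, T.traceR S t)

/-- `t` is an `S`-bottom node. The nodes with a given `S`-trace whose first component is nonempty
form a directed path; `t` is its bottom node, that is, all nodes of this path are ancestors of `t`
(or `t` itself). -/
def IsSBottom (T : RootedTreeDecomposition G ι) (S : Set V) (t : ι) : Prop :=
  (T.traceL S t).Nonempty ∧ ∀ s, T.trace S s = T.trace S t → T.InSubtree s t

/-- The set of `S`-children of `t`. -/
def sChildren (T : RootedTreeDecomposition G ι) (S : Set V) (t : ι) : Set ι :=
  {c | T.IsParent t c ∧
    ((T.traceL S c ∪ T.traceX S c) \ (T.traceR S t ∪ T.traceX S t)).Nonempty}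

/-- The condition for `t` to admit the `S`-operation `introduce(v)`. -/
def AdmitsIntroduce (T : RootedTreeDecomposition G ι) (S : Set V) (t : ι) (v : V) : Prop :=
  ∃ t₁, T.sChildren S t = {t₁} ∧ v ∈ S \ T.bag t₁ ∧ T.traceX S t = T.traceX S t₁ ∪ {v}

/-- The condition for `t` to admit the `S`-operation `forget(v)`. -/
def AdmitsForget (T : RootedTreeDecomposition G ι) (S : Set V) (t : ι) (v : V) : Prop :=
  ∃ t₁, T.sChildren S t = {t₁} ∧ v ∈ S ∩ T.bag t₁ ∧ T.traceX S t = T.traceX S t₁ \ {v}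

/-- The condition for `t` to admit a `join` as its `S`-operation. -/
def AdmitsJoin (T : RootedTreeDecomposition G ι) (S : Set V) (t : ι) : Prop :=
  ∃ t₁ t₂, t₁ ≠ t₂ ∧ T.sChildren S t = {t₁, t₂} ∧
    T.traceX S t₁ ∪ T.traceX S t₂ ⊆ T.traceX S t

/-- `S`-nice rooted tree decompositions. -/
structure IsSNice (T : RootedTreeDecomposition G ι) (S : Set V) : Prop where
  bag_parent : ∀ p t, T.IsParent p t →
    (T.bag t ⊆ T.bag p ∨ T.bag p ⊆ T.bag t) ∧
      -1 ≤ ((T.bag t).ncard : ℤ) - (T.bag p).ncard ∧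
      ((T.bag t).ncard : ℤ) - (T.bag p).ncard ≤ 1
  operation : ∀ t, T.IsSBottom S t →
    (∃ v, T.AdmitsIntroduce S t v) ∨ (∃ v, T.AdmitsForget S t v) ∨ T.AdmitsJoin S t

/-- `F` is (the node set of) a full join tree: an inclusion-maximal non-trivial subtree all of
whose nodes have the same full bag. -/
def IsFullJoinTree (T : RootedTreeDecomposition G ι) (F : Set ι) : Prop :=
  Maximal (fun F' : Set ι => F'.Nontrivial ∧ (T.tree.induce F').Connected ∧
    ∃ X : Set V, (X.ncard : ℤ) = T.width + 1 ∧ ∀ t ∈ F', T.bag t = X) F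

/-- `r` is the root of the subtree with node set `F`. -/
def IsRootOf (T : RootedTreeDecomposition G ι) (F : Set ι) (r : ι) : Prop :=
  r ∈ F ∧ ∀ t ∈ F, T.InSubtree r t

/-- `P` is the part of the vertices that belongs to the node `s` attached to the subtree with node
set `F` and root `r`: either `s` is an `S`-child, outside of `F`, of a node of `F` and `P = V_s`,
or `s` is the parent of `r` and `P = V \ V_r`. -/
def IsPart (T : RootedTreeDecomposition G ι) (S : Set V) (F : Set ι) (r s : ι) (P : Set V) :
    Prop :=
  (s ∉ F ∧ (∃ t ∈ F, s ∈ T.sChildren S t) ∧ P = T.subtreeVerts s) ∨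
    (T.IsParent s r ∧ P = (T.subtreeVerts r)ᶜ)

/-- Slim rooted tree decompositions (to be used for `S`-nice ones). "Full" refers to the width of
`T` itself. Since the root is not an `S`-bottom node, every `S`-bottom node has a parent. -/
structure IsSlim (T : RootedTreeDecomposition G ι) (S : Set V) : Prop where
  root_not_bottom : ¬ T.IsSBottom S T.root
  join_bags : ∀ t, T.IsSBottom S t → (T.sChildren S t).ncard = 2 →
    (∃ F, T.IsFullJoinTree F ∧ t ∈ F) ∨
      ∀ s, (s ∈ T.sChildren S t ∨ T.IsParent s t) →
        ¬ T.IsFull s ∧ (T.bag s).ncard ≤ (T.bag t).ncard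
  not_full_parent : ∀ t, T.IsSBottom S t → ¬ T.IsFull t → ∀ p, T.IsParent p t →
    T.bag t = T.bag p ∧ T.sChildren S p = {t}
  forget_child : ∀ t, T.IsSBottom S t → ∀ v ∈ S, T.AdmitsForget S t v →
    ∀ c ∈ T.sChildren S t, ¬ T.IsFull c →
      (T.sChildren S c).Subsingleton ∧ ∀ d ∈ T.sChildren S c, T.bag c = T.bag d
  parent_parent : ∀ t, T.IsSBottom S t → ∀ p, T.IsParent p t → ¬ T.IsFull p →
    p = T.root ∨ ∀ q, T.IsParent q p → ¬ T.IsSBottom S q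
  fullJoinTree_bottom : ∀ F, T.IsFullJoinTree F → ∀ t ∈ F,
    T.IsSBottom S t ∧ (T.sChildren S t).ncard = 2
  /-- Three neighbors of `v` outside of `X`, connected to `S` in `G - X`, in the parts of three
  different nodes attached to the full join tree. -/
  fullJoinTree_neighbors : ∀ F, T.IsFullJoinTree F → ∀ X : Set V, (∀ t ∈ F, T.bag t = X) →
    ∀ r, T.IsRootOf F r → ∀ v ∈ X \ S,
      ∃ (u : Fin 3 → V) (t : Fin 3 → ι), Function.Injective u ∧ Function.Injective t ∧
        ∀ i, G.Adj v (u i) ∧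
          (∃ (hu : u i ∈ Xᶜ) (s : V) (hs : s ∈ Xᶜ), s ∈ S ∧
            (G.induce Xᶜ).Reachable ⟨u i, hu⟩ ⟨s, hs⟩) ∧
          ∃ P : Set V, T.IsPart S F r (t i) P ∧ u i ∈ P

end RootedTreeDecomposition

/-- The vertex set in `G` of a connected component of `G[A]`. -/
def componentVerts {V : Type*} {G : SimpleGraph V} {A : Set V}
    (C : (G.induce A).ConnectedComponent) : Set V :=
  Subtype.val '' C.supp

/-- A connected component of an induced subgraph is an `S`-component if it contains a vertex
of `S`. -/
def IsSComponent {V : Type*} {G : SimpleGraph V} {A : Set V} (S : Set V)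
    (C : (G.induce A).ConnectedComponent) : Prop :=
  (componentVerts C ∩ S).Nonempty

/-! Of the given decomposition only an exchange property of its bags is kept. If $Z$ lies in a bag
and $D$ is a connected set with $Z \subseteq N(D)$, then $Z \cup \{d\}$ lies in a bag for some $d
\in D$ (`exists_insert_subset_bag`). This allows a recursive decomposition: below the bag $N(C) \cup
\{d\}$ of a connected set $C$ come the components of $C \setminus \{d\}$. Families of sets with this
property are abstracted as `IsBagFamily`, and $W$ is the least bound on the set size for which one
exists. The decomposition built from such a family yields a bag family itself, so its width is
exactly $W-1$, and full bags are those of size $W$.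

Slimness is reduced to conditions on a node, its children and its grandchildren (`SlimLocal`). At
bags that are not full these cost nothing: copies of nodes separate consecutive operations, and
joins take place between equal bags. The problem is a full bag $X$ with at least three components of
$G-X$ below it that meet $S$ (call them $S$-components); it is solved in `piece_assemble`. If every
$v \in X \setminus S$ sees three $S$-components in different parts, a path of nodes with bag $X$
serves as a full join tree. Otherwise some $v$ fails, and the $S$-components not adjacent to $v$ can
be joined at the smaller bag $X \setminus \{v\}$. If $v$ may be forgotten above $X$, at most two
$S$-components see $v$, and these alone are attached to $X$. If $v$ has to stay in the bag $Z$
above, $v$ is required to see an $S$-component outside; then at most one below sees $v$, and the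
collected others form the second $S$-child.

That requirement on $Z$ is met by replacing $C$ by its hull (`IsHull`): only those neighbors of $C$
that are in $S$, or that see $S$ away from $C$, are kept as separator, and the rest is absorbed into
the part below. Hulls contain no new vertices of $S$ and do not swallow one another's separators, so
the recursion survives the replacement (`piece_of_isHull`). -/

/-- Finite rooted trees whose nodes are labelled by sets of vertices. -/
inductive BagTree (V : Type*) : Type _
  | node (X : Set V) (n : ℕ) (cs : Fin n → BagTree V) : BagTree V

/-! ### Trees of bags as rooted tree decompositions -/

namespace BagTree

variable {V : Type*}

/-- The bag of the root. -/
def bag : BagTree V → Set V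
  | node X _ _ => X

/-- The number of children of the root. -/
def arity : BagTree V → ℕ
  | node _ n _ => n

/-- The subtrees below the root. -/
def child : (t : BagTree V) → Fin t.arity → BagTree V
  | node _ _ cs => cs

/-- The union of all bags. -/
def verts : BagTree V → Set V
  | node X _ cs => X ∪ ⋃ i, verts (cs i)

/-- The predicate `p` holds at every subtree. -/
def All (p : BagTree V → Prop) : BagTree V → Prop
  | node X n cs => p (node X n cs) ∧ ∀ i, All p (cs i)

/-- Some bag contains both `u` and `v`. -/
def InSomeBag (u v : V) : BagTree V → Prop
  | node X _ cs => (u ∈ X ∧ v ∈ X) ∨ ∃ i, InSomeBag u v (cs i)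

@[simp] theorem bag_node (X : Set V) (n : ℕ) (cs : Fin n → BagTree V) : (node X n cs).bag = X := rfl

@[simp] theorem arity_node (X : Set V) (n : ℕ) (cs : Fin n → BagTree V) :
    (node X n cs).arity = n := rfl

@[simp] theorem child_node (X : Set V) (n : ℕ) (cs : Fin n → BagTree V) :
    (node X n cs).child = cs := rfl

theorem verts_eq (t : BagTree V) : t.verts = t.bag ∪ ⋃ i, (t.child i).verts := by
  cases t; rfl

theorem all_iff (p : BagTree V → Prop) (t : BagTree V) :
    All p t ↔ p t ∧ ∀ i, All p (t.child i) := by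
  cases t; rfl

theorem inSomeBag_iff (u v : V) (t : BagTree V) :
    InSomeBag u v t ↔ (u ∈ t.bag ∧ v ∈ t.bag) ∨ ∃ i, InSomeBag u v (t.child i) := by
  cases t; rfl

theorem bag_subset_verts (t : BagTree V) : t.bag ⊆ t.verts := by
  rw [verts_eq]; exact Set.subset_union_left

theorem verts_child_subset (t : BagTree V) (i : Fin t.arity) : (t.child i).verts ⊆ t.verts := by
  rw [verts_eq t]
  exact (Set.subset_iUnion (fun i => (t.child i).verts) i).trans Set.subset_union_right

theorem child_induction {p : BagTree V → Prop}
    (h : ∀ t, (∀ i, p (t.child i)) → p t) : ∀ t, p t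
  | node X n cs => h (node X n cs) fun i => child_induction h (cs i)

/-- The subtree at an address; the address of the `i`-th child is `i` prepended to the address of
its parent. -/
def sub (t : BagTree V) : List ℕ → Option (BagTree V)
  | [] => some t
  | i :: l => (sub t l).bind fun s => if h : i < s.arity then some (s.child ⟨i, h⟩) else none

/-- The nodes, represented by their addresses. -/
def Nodes (t : BagTree V) : Type := {l : List ℕ // (t.sub l).isSome}

/-- The subtree at a node. -/
def subAt (t : BagTree V) (x : t.Nodes) : BagTree V := (t.sub x.1).get x.2

theorem sub_eq (t : BagTree V) (x : t.Nodes) : t.sub x.1 = some (t.subAt x) := by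
  simp [subAt]

theorem subAt_eq_of_sub {t : BagTree V} {x : t.Nodes} {s : BagTree V} (h : t.sub x.1 = some s) :
    t.subAt x = s := by
  simp [subAt, h]

/-- The root. -/
def rootNode (t : BagTree V) : t.Nodes := ⟨[], rfl⟩

@[simp] theorem subAt_rootNode (t : BagTree V) : t.subAt t.rootNode = t := rfl

theorem sub_cons (t : BagTree V) (x : t.Nodes) (i : Fin (t.subAt x).arity) :
    t.sub (i.1 :: x.1) = some ((t.subAt x).child i) := by
  simp [sub, sub_eq]

/-- The `i`-th child of a node. -/
def childNode (t : BagTree V) (x : t.Nodes) (i : Fin (t.subAt x).arity) : t.Nodes :=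
  ⟨i.1 :: x.1, by rw [sub_cons]; rfl⟩

@[simp] theorem subAt_childNode (t : BagTree V) (x : t.Nodes) (i : Fin (t.subAt x).arity) :
    t.subAt (t.childNode x i) = (t.subAt x).child i :=
  subAt_eq_of_sub (sub_cons t x i)

/-- `x` is the parent of `y`. -/
def Par (t : BagTree V) (x y : t.Nodes) : Prop := ∃ i, y = t.childNode x i

theorem childNode_injective (t : BagTree V) (x : t.Nodes) :
    Function.Injective (t.childNode x) := by
  intro i j h
  have := congrArg Subtype.val h
  simp only [childNode, List.cons.injEq, and_true] at this
  exact Fin.ext this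

theorem eq_rootNode_or_exists_par (t : BagTree V) (y : t.Nodes) :
    y = t.rootNode ∨ ∃ x, t.Par x y := by
  obtain ⟨l, hl⟩ := y
  cases l with
  | nil => exact Or.inl rfl
  | cons i l =>
    right
    cases hs : t.sub l with
    | none => simp [sub, hs] at hl
    | some s =>
      have hx : (t.sub l).isSome := by simp [hs]
      have hat : t.subAt ⟨l, hx⟩ = s := subAt_eq_of_sub hs
      have hi : i < s.arity := by
        by_contra hi
        simp [sub, hs, hi] at hl
      exact ⟨⟨l, hx⟩, ⟨i, by rw [hat]; exact hi⟩, rfl⟩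

theorem Par.val_eq {t : BagTree V} {x y : t.Nodes} (h : t.Par x y) : ∃ i, y.1 = i :: x.1 := by
  obtain ⟨i, rfl⟩ := h; exact ⟨i, rfl⟩

theorem Par.length {t : BagTree V} {x y : t.Nodes} (h : t.Par x y) :
    y.1.length = x.1.length + 1 := by
  obtain ⟨i, hi⟩ := h.val_eq; simp [hi]

theorem Par.unique {t : BagTree V} {x x' y : t.Nodes} (h : t.Par x y) (h' : t.Par x' y) :
    x = x' := by
  obtain ⟨i, hi⟩ := h.val_eq
  obtain ⟨j, hj⟩ := h'.val_eq
  rw [hi, List.cons.injEq] at hj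
  exact Subtype.ext hj.2

/-- Addresses grow at the front, so the last entry is the step taken at the root. This gives access
to structural induction on the tree. -/
theorem sub_append (X : Set V) (n : ℕ) (cs : Fin n → BagTree V) (i : ℕ) (l : List ℕ) :
    (node X n cs).sub (l ++ [i]) = if h : i < n then (cs ⟨i, h⟩).sub l else none := by
  induction l with
  | nil => simp [sub]; rfl
  | cons j l ih =>
    simp only [List.cons_append, sub, ih]
    split <;> simp

theorem finite_addresses (t : BagTree V) : {l : List ℕ | (t.sub l).isSome}.Finite := by
  induction t with
  | node X n cs ih =>
    refine ((Set.finite_singleton []).union (Set.finite_iUnion fun i : Fin n =>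
      (ih i).image (· ++ [i.1]))).subset ?_
    intro l hl
    rcases List.eq_nil_or_concat l with rfl | ⟨m, i, rfl⟩
    · exact Or.inl rfl
    · right
      rw [Set.mem_ofPred_eq, List.concat_eq_append, sub_append] at hl
      split at hl
      · rename_i h
        exact Set.mem_iUnion.2 ⟨⟨i, h⟩, m, hl, by simp⟩
      · simp at hl

instance (t : BagTree V) : Finite t.Nodes := t.finite_addresses.to_subtype

/-- The underlying graph on the nodes. -/
def graph (t : BagTree V) : SimpleGraph t.Nodes where
  Adj x y := t.Par x y ∨ t.Par y x
  symm := ⟨fun _ _ h => h.symm⟩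
  loopless := ⟨fun x h => by
    have h' : t.Par x x := h.elim id id
    have := h'.length
    omega⟩

/-- `y` is a descendant of `x`. -/
def Desc (t : BagTree V) : t.Nodes → t.Nodes → Prop := Relation.ReflTransGen t.Par

theorem desc_rootNode (t : BagTree V) (y : t.Nodes) : t.Desc t.rootNode y := by
  induction h : y.1.length generalizing y with
  | zero =>
    rcases t.eq_rootNode_or_exists_par y with rfl | ⟨x, hx⟩
    · exact .refl
    · have := hx.length; omega
  | succ n ih =>
    rcases t.eq_rootNode_or_exists_par y with rfl | ⟨x, hx⟩
    · exact .refl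
    · have := hx.length
      exact (ih x (by omega)).tail hx

theorem Desc.suffix {t : BagTree V} {x y : t.Nodes} (h : t.Desc x y) : x.1 <:+ y.1 := by
  induction h with
  | refl => exact List.suffix_refl _
  | tail _ h ih =>
    obtain ⟨i, hi⟩ := h.val_eq
    rw [hi]
    exact ih.trans (List.suffix_cons _ _)

theorem Desc.exists_walk {t : BagTree V} {x y : t.Nodes} (h : t.Desc x y) :
    ∃ w : t.graph.Walk x y, x.1.length + w.length = y.1.length := by
  induction h with
  | refl => exact ⟨.nil, rfl⟩
  | @tail y z _ h ih =>
    obtain ⟨w, hw⟩ := ih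
    have hadj : t.graph.Adj y z := Or.inl h
    refine ⟨w.concat hadj, ?_⟩
    rw [SimpleGraph.Walk.length_concat, h.length]
    omega

theorem graph_connected (t : BagTree V) : t.graph.Connected := by
  have h : ∀ y, t.graph.Reachable t.rootNode y := fun y => by
    obtain ⟨w, -⟩ := (t.desc_rootNode y).exists_walk
    exact ⟨w⟩
  have : Nonempty t.Nodes := ⟨t.rootNode⟩
  exact ⟨fun x y => (h x).symm.trans (h y)⟩

/-- The nodes below `c` are those whose address ends in that of `c`, and the edge to the parent `p`
is the only one leaving this set. Hence every edge is a bridge. -/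
theorem suffix_of_reachable {t : BagTree V} {p c : t.Nodes} (hpc : t.Par p c) {x y : t.Nodes}
    (w : (t.graph.deleteEdges {s(p, c)}).Walk x y) (hx : c.1 <:+ x.1) : c.1 <:+ y.1 := by
  induction w with
  | nil => exact hx
  | cons h _ ih =>
    apply ih
    rw [SimpleGraph.deleteEdges_adj] at h
    obtain ⟨h, hne⟩ := h
    rcases h with h | h
    · obtain ⟨i, hi⟩ := h.val_eq
      rw [hi]
      exact hx.trans (List.suffix_cons _ _)
    · obtain ⟨i, hi⟩ := h.val_eq
      rw [hi, List.suffix_cons_iff] at hx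
      rcases hx with hx | hx
      · exfalso
        rename_i u v _ _
        have hu : u = c := Subtype.ext (hi.trans hx.symm)
        subst hu
        rw [hpc.unique h, Sym2.eq_swap] at hne
        exact hne rfl
      · exact hx

theorem graph_isTree (t : BagTree V) : t.graph.IsTree := by
  refine ⟨t.graph_connected, ?_⟩
  have key : ∀ p c, t.Par p c → t.graph.IsBridge s(p, c) := by
    intro p c h
    rw [SimpleGraph.isBridge_iff]
    rintro ⟨w⟩
    have := (suffix_of_reachable h w.reverse (List.suffix_refl _)).length_le
    have := h.length
    omega
  rw [SimpleGraph.isAcyclic_iff_forall_adj_isBridge]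
  rintro p c (h | h)
  · exact key p c h
  · rw [Sym2.eq_swap]
    exact key c p h

theorem length_le_of_walk {t : BagTree V} {x y : t.Nodes} (w : t.graph.Walk x y) :
    y.1.length ≤ x.1.length + w.length := by
  induction w with
  | nil => simp
  | cons h _ ih =>
    rw [SimpleGraph.Walk.length_cons]
    rcases h with h | h <;> have := h.length <;> omega

/-- Each edge changes the address length by one, so the descent from the root is a shortest walk.
Since `IsParent` compares distances to the root, it thereby agrees with `Par`. -/
theorem dist_rootNode (t : BagTree V) (y : t.Nodes) :
    t.graph.dist t.rootNode y = y.1.length := by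
  obtain ⟨w, hw⟩ := (t.desc_rootNode y).exists_walk
  obtain ⟨w', hw'⟩ := t.graph_connected.exists_walk_length_eq_dist t.rootNode y
  have h1 := SimpleGraph.dist_le w
  have h2 := length_le_of_walk w'
  have h3 : t.rootNode.1.length = 0 := rfl
  omega

theorem mem_verts_iff (t : BagTree V) (v : V) (x : t.Nodes) :
    v ∈ (t.subAt x).verts ↔ ∃ y, t.Desc x y ∧ v ∈ (t.subAt y).bag := by
  constructor
  · intro hv
    induction hs : t.subAt x using child_induction generalizing x with
    | h s ih =>
      subst hs
      rw [verts_eq] at hv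
      rcases hv with hv | hv
      · exact ⟨x, .refl, hv⟩
      · obtain ⟨i, hi⟩ := Set.mem_iUnion.1 hv
        obtain ⟨y, hy, hvy⟩ := ih i (t.childNode x i) (by simpa using hi) (by simp)
        exact ⟨y, .head ⟨i, rfl⟩ hy, hvy⟩
  · rintro ⟨y, hy, hv⟩
    induction hy using Relation.ReflTransGen.head_induction_on with
    | refl => exact bag_subset_verts _ hv
    | head h _ ih =>
      obtain ⟨i, rfl⟩ := h
      rw [subAt_childNode] at ih
      exact verts_child_subset _ i ih

theorem exists_node_of_inSomeBag (t : BagTree V) (u v : V) (x : t.Nodes)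
    (h : InSomeBag u v (t.subAt x)) : ∃ y, u ∈ (t.subAt y).bag ∧ v ∈ (t.subAt y).bag := by
  induction hs : t.subAt x using child_induction generalizing x with
  | h s ih =>
    subst hs
    rw [inSomeBag_iff] at h
    rcases h with h | ⟨i, hi⟩
    · exact ⟨x, h⟩
    · exact ih i (t.childNode x i) (by simpa using hi) (by simp)

theorem All.subAt {p : BagTree V → Prop} {t : BagTree V} (h : All p t) (x : t.Nodes) :
    p (t.subAt x) := by
  have : All p (t.subAt x) := by
    induction t.desc_rootNode x with
    | refl => exact h
    | tail _ hp ih =>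
      obtain ⟨i, rfl⟩ := hp
      rw [subAt_childNode]
      exact ((all_iff _ _).1 ih).2 i
  exact ((all_iff _ _).1 this).1

/-- The local form of the running intersection property. -/
structure Valid (t : BagTree V) : Prop where
  child : ∀ i, (t.child i).verts ∩ t.bag ⊆ (t.child i).bag
  children : ∀ i j, i ≠ j → (t.child i).verts ∩ (t.child j).verts ⊆ t.bag

theorem reachable_of_desc {t : BagTree V} (ht : All Valid t) {v : V} {x y : t.Nodes}
    (hxy : t.Desc x y) (hx : v ∈ (t.subAt x).bag) (hy : v ∈ (t.subAt y).bag) :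
    (t.graph.induce {z | v ∈ (t.subAt z).bag}).Reachable ⟨x, hx⟩ ⟨y, hy⟩ := by
  induction hxy using Relation.ReflTransGen.head_induction_on with
  | refl => exact .refl _
  | @head x z h hzy ih =>
    obtain ⟨i, rfl⟩ := h
    have hv : v ∈ (t.subAt (t.childNode x i)).verts := (t.mem_verts_iff v _).2 ⟨y, hzy, hy⟩
    have hz : v ∈ (t.subAt (t.childNode x i)).bag := by
      rw [subAt_childNode] at hv ⊢
      exact (ht.subAt x).child i ⟨hv, hx⟩
    refine SimpleGraph.Reachable.trans (SimpleGraph.Adj.reachable ?_) (ih hz)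
    exact (Or.inl ⟨i, rfl⟩ : t.graph.Adj x (t.childNode x i))

/-- Move the common ancestor down. Once its bag contains `v`, both nodes are reached from it. Before
that, both lie below the same child, since `v` occurring below two children would be in the bag. -/
theorem reachable_of_common_ancestor {t : BagTree V} (ht : All Valid t) {v : V} {x y z : t.Nodes}
    (hxy : t.Desc x y) (hxz : t.Desc x z) (hy : v ∈ (t.subAt y).bag) (hz : v ∈ (t.subAt z).bag) :
    (t.graph.induce {z | v ∈ (t.subAt z).bag}).Reachable ⟨y, hy⟩ ⟨z, hz⟩ := by
  induction hs : t.subAt x using child_induction generalizing x with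
  | h s ih =>
    subst hs
    by_cases hx : v ∈ (t.subAt x).bag
    · exact (reachable_of_desc ht hxy hx hy).symm.trans (reachable_of_desc ht hxz hx hz)
    · rcases hxy.cases_head with rfl | ⟨_, ⟨i, rfl⟩, hiy⟩
      · exact absurd hy hx
      rcases hxz.cases_head with rfl | ⟨_, ⟨j, rfl⟩, hjz⟩
      · exact absurd hz hx
      by_cases hij : i = j
      · subst hij
        exact ih i hiy hjz (by simp)
      · exfalso
        apply hx
        apply (ht.subAt x).children i j hij
        rw [← subAt_childNode, ← subAt_childNode]
        exact ⟨(t.mem_verts_iff v _).2 ⟨y, hiy, hy⟩, (t.mem_verts_iff v _).2 ⟨z, hjz, hz⟩⟩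

/-- The rooted tree decomposition given by a tree of bags. -/
def toDecomposition {G : SimpleGraph V} {t : BagTree V} (ht : All Valid t)
    (hv : t.verts = Set.univ) (he : ∀ u v, G.Adj u v → InSomeBag u v t) :
    RootedTreeDecomposition G t.Nodes where
  tree := t.graph
  isTree := t.graph_isTree
  root := t.rootNode
  bag x := (t.subAt x).bag
  iUnion_bag := by
    ext v
    have : v ∈ (t.subAt t.rootNode).verts := by simp [hv]
    obtain ⟨y, -, hy⟩ := (t.mem_verts_iff v _).1 this
    simpa using ⟨y, hy⟩
  exists_bag_of_adj u v h := t.exists_node_of_inSomeBag u v t.rootNode (he u v h)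
  connected_bag v := by
    have : v ∈ (t.subAt t.rootNode).verts := by simp [hv]
    obtain ⟨y, -, hy⟩ := (t.mem_verts_iff v _).1 this
    have : Nonempty {z | v ∈ (t.subAt z).bag} := ⟨⟨y, hy⟩⟩
    exact ⟨fun y z => reachable_of_common_ancestor ht (t.desc_rootNode _) (t.desc_rootNode _)
      y.2 z.2⟩

end BagTree

/-! ### Connected sets and components of $G - X$ -/

section Components

variable {V : Type*} (G : SimpleGraph V)

/-- `C` is nonempty and connected: no proper nonempty subset is closed under adjacency in `C`. -/
def ConnSet (C : Set V) : Prop :=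
  C.Nonempty ∧ ∀ B ⊆ C, B.Nonempty → (∀ b ∈ B, ∀ c ∈ C, G.Adj b c → c ∈ B) → B = C

/-- The vertices outside of `C` with a neighbor in `C`. -/
def outerNbhd (C : Set V) : Set V := {v | v ∉ C ∧ ∃ c ∈ C, G.Adj c v}

/-- `E` is the vertex set of a connected component of `G - X`. -/
structure IsComp (X E : Set V) : Prop where
  conn : ConnSet G E
  disj : Disjoint E X
  nbhd : outerNbhd G E ⊆ X

variable {G}

theorem IsComp.mem_of_adj {X E : Set V} (h : IsComp G X E) {u v : V} (hu : u ∈ E)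
    (hv : v ∉ X) (huv : G.Adj u v) : v ∈ E := by
  by_contra hvE
  exact hv (h.nbhd ⟨hvE, u, hu, huv⟩)

theorem IsComp.mem_of_reachable {X E : Set V} (h : IsComp G X E) {u v : ↥Xᶜ}
    (huv : (G.induce Xᶜ).Reachable u v) (hu : u.1 ∈ E) : v.1 ∈ E := by
  obtain ⟨w⟩ := huv
  induction w with
  | nil => exact hu
  | @cons a b _ hab _ ih => exact ih (h.mem_of_adj hu b.2 hab)

theorem IsComp.reachable {X E : Set V} (h : IsComp G X E) {u v : V} (hu : u ∈ E) (hv : v ∈ E) :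
    (G.induce Xᶜ).Reachable ⟨u, h.disj.notMem_of_mem_left hu⟩
      ⟨v, h.disj.notMem_of_mem_left hv⟩ := by
  have := h.conn.2 {x | ∃ hx : x ∈ E, (G.induce Xᶜ).Reachable
    ⟨u, h.disj.notMem_of_mem_left hu⟩ ⟨x, h.disj.notMem_of_mem_left hx⟩} (fun x hx => hx.1)
    ⟨u, hu, .refl _⟩ (by
      rintro b ⟨hb, hub⟩ c hc hbc
      refine ⟨hc, hub.trans (SimpleGraph.Adj.reachable ?_)⟩
      exact hbc)
  rw [← this] at hv
  exact hv.2

theorem IsComp.exists_connectedComponent {X E : Set V} (h : IsComp G X E) :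
    ∃ C : (G.induce Xᶜ).ConnectedComponent, componentVerts C = E := by
  obtain ⟨u, hu⟩ := h.conn.1
  refine ⟨(G.induce Xᶜ).connectedComponentMk ⟨u, h.disj.notMem_of_mem_left hu⟩, ?_⟩
  ext v
  constructor
  · rintro ⟨w, hw, rfl⟩
    exact h.mem_of_reachable (SimpleGraph.ConnectedComponent.exact hw).symm hu
  · intro hv
    exact ⟨⟨v, h.disj.notMem_of_mem_left hv⟩,
      SimpleGraph.ConnectedComponent.sound (h.reachable hv hu), rfl⟩

end Components

/-! ### Local conditions and their translation to decompositions -/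

namespace BagTree

variable {V : Type*}

/-- The `i`-th child of the root is an `S`-child. -/
def SChild (S : Set V) (t : BagTree V) (i : Fin t.arity) : Prop :=
  (((t.child i).verts \ t.bag) ∩ S).Nonempty

/-- The root has exactly two `S`-children. -/
def TwoS (S : Set V) (t : BagTree V) : Prop :=
  ∃ i j, i ≠ j ∧ ∀ k, SChild S t k ↔ k = i ∨ k = j

/-- There is a vertex of `S` below the root and no child of the root has the same `S`-trace. -/
def Bot (S : Set V) (t : BagTree V) : Prop :=
  ((t.verts \ t.bag) ∩ S).Nonempty ∧
    ∀ i, ¬ ((t.child i).verts ∩ S = t.verts ∩ S ∧ (t.child i).bag ∩ S = t.bag ∩ S)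

/-- `P` is the vertex set of the subtree of an `S`-child attached to the region of nodes with bag
`X` around the root. -/
inductive IsPartSet (S X : Set V) : BagTree V → Set V → Prop
  | here (t : BagTree V) (i : Fin t.arity) (h : SChild S t i) (hX : (t.child i).bag ≠ X) :
      IsPartSet S X t (t.child i).verts
  | there (t : BagTree V) (i : Fin t.arity) (P : Set V) (hX : (t.child i).bag = X)
      (h : IsPartSet S X (t.child i) P) : IsPartSet S X t P

/-- Every vertex of the root bag `X` outside of `S` has neighbors in three components of `G - X`
that meet `S` and lie in different parts. -/
def HasThreeParts (G : SimpleGraph V) (S : Set V) (t : BagTree V) : Prop :=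
  ∀ v ∈ t.bag \ S, ∃ C P : Fin 3 → Set V, Function.Injective P ∧
    (∀ i j, i ≠ j → Disjoint (C i) (C j)) ∧
    ∀ i, IsComp G t.bag (C i) ∧ (C i ∩ S).Nonempty ∧ (∃ u ∈ C i, G.Adj v u) ∧ C i ⊆ P i ∧
      (IsPartSet S t.bag t (P i) ∨ P i = t.vertsᶜ)

/-- Conditions on a node, its children and its grandchildren that together imply slimness. -/
structure SlimLocal (G : SimpleGraph V) (S : Set V) (W : ℕ) (q : BagTree V) : Prop where
  valid : Valid q
  card_le : q.bag.ncard ≤ W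
  bag_child : ∀ i, ((q.child i).bag ⊆ q.bag ∨ q.bag ⊆ (q.child i).bag) ∧
    (q.child i).bag.ncard ≤ q.bag.ncard + 1 ∧ q.bag.ncard ≤ (q.child i).bag.ncard + 1
  sChild : (∀ i j, SChild S q i → SChild S q j → i = j) ∨
    (TwoS S q ∧ ∀ i, SChild S q i → (q.child i).bag ∩ S ⊆ q.bag)
  join_child : ∀ i, TwoS S (q.child i) →
    ((q.child i).bag.ncard = W ∧
      (q.bag = (q.child i).bag ∨ ∃ j, ((q.child i).child j).bag = (q.child i).bag)) ∨
    ((q.bag.ncard < W ∧ q.bag.ncard ≤ (q.child i).bag.ncard) ∧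
      ∀ j, SChild S (q.child i) j →
        ((q.child i).child j).bag.ncard < W ∧
          ((q.child i).child j).bag.ncard ≤ (q.child i).bag.ncard)
  bot_child : ∀ i, Bot S (q.child i) → (q.child i).bag.ncard < W →
    (q.child i).bag = q.bag ∧ ∀ j, SChild S q j → j = i
  forget_child : Bot S q → ∀ i, SChild S q i → (q.child i).bag.ncard < W →
    ¬ (q.child i).bag ⊆ q.bag →
    (∀ j k, SChild S (q.child i) j → SChild S (q.child i) k → j = k) ∧
      ∀ j, SChild S (q.child i) j → (q.child i).bag = ((q.child i).child j).bag
  grandchild : ∀ i j, Bot S ((q.child i).child j) → (q.child i).bag.ncard < W → ¬ Bot S q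
  full_child : ∀ i, q.bag.ncard = W → (q.child i).bag = q.bag →
    TwoS S q ∧ TwoS S (q.child i)
  parts_child : ∀ i, (q.child i).bag.ncard = W → (q.child i).bag ≠ q.bag →
    (∃ j, ((q.child i).child j).bag = (q.child i).bag) → HasThreeParts G S (q.child i)

section Decomposition

variable {G : SimpleGraph V} {t : BagTree V} (ht : All Valid t)
  (hv : t.verts = Set.univ) (he : ∀ u v, G.Adj u v → InSomeBag u v t)

@[simp] theorem toDecomposition_bag (x : t.Nodes) :
    (toDecomposition ht hv he).bag x = (t.subAt x).bag := rfl

@[simp] theorem toDecomposition_tree : (toDecomposition ht hv he).tree = t.graph := rfl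

@[simp] theorem toDecomposition_root : (toDecomposition ht hv he).root = t.rootNode := rfl

theorem toDecomposition_isParent {p c : t.Nodes} :
    (toDecomposition ht hv he).IsParent p c ↔ t.Par p c := by
  unfold RootedTreeDecomposition.IsParent
  simp only [toDecomposition_tree, toDecomposition_root, dist_rootNode]
  constructor
  · rintro ⟨h | h, hlt⟩
    · exact h
    · have := h.length; omega
  · intro h
    have := h.length
    exact ⟨Or.inl h, by omega⟩

theorem toDecomposition_inSubtree {x y : t.Nodes} :
    (toDecomposition ht hv he).InSubtree x y ↔ t.Desc x y := by
  unfold RootedTreeDecomposition.InSubtree Desc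
  have : (toDecomposition ht hv he).IsParent = t.Par := by
    ext p c; exact toDecomposition_isParent ht hv he
  rw [this]

theorem toDecomposition_subtreeVerts (x : t.Nodes) :
    (toDecomposition ht hv he).subtreeVerts x = (t.subAt x).verts := by
  ext v
  rw [mem_verts_iff]
  simp only [RootedTreeDecomposition.subtreeVerts, toDecomposition_inSubtree, Set.mem_ofPred_eq,
    toDecomposition_bag]

theorem toDecomposition_traceL (S : Set V) (x : t.Nodes) :
    (toDecomposition ht hv he).traceL S x = ((t.subAt x).verts \ (t.subAt x).bag) ∩ S := by
  rw [RootedTreeDecomposition.traceL, toDecomposition_subtreeVerts, toDecomposition_bag]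

theorem toDecomposition_traceX (S : Set V) (x : t.Nodes) :
    (toDecomposition ht hv he).traceX S x = (t.subAt x).bag ∩ S := rfl

theorem toDecomposition_traceR (S : Set V) (x : t.Nodes) :
    (toDecomposition ht hv he).traceR S x = ((t.subAt x).verts)ᶜ ∩ S := by
  rw [RootedTreeDecomposition.traceR, toDecomposition_subtreeVerts]

theorem toDecomposition_trace_eq_iff (S : Set V) (x y : t.Nodes) :
    (toDecomposition ht hv he).trace S x = (toDecomposition ht hv he).trace S y ↔
      (t.subAt x).verts ∩ S = (t.subAt y).verts ∩ S ∧
        (t.subAt x).bag ∩ S = (t.subAt y).bag ∩ S := by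
  have hx := bag_subset_verts (t.subAt x)
  have hy := bag_subset_verts (t.subAt y)
  simp only [RootedTreeDecomposition.trace, Prod.mk.injEq, toDecomposition_traceL,
    toDecomposition_traceX, toDecomposition_traceR, Set.ext_iff, Set.mem_inter_iff, Set.mem_sdiff,
    Set.mem_compl_iff]
  constructor
  · rintro ⟨h1, h2, h3⟩
    refine ⟨fun v => ?_, h2⟩
    have := h3 v
    tauto
  · rintro ⟨h1, h2⟩
    refine ⟨fun v => ?_, h2, fun v => ?_⟩ <;> have := h1 v <;> have := h2 v <;> tauto

theorem toDecomposition_childNode_mem_sChildren (S : Set V) (x : t.Nodes)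
    (i : Fin (t.subAt x).arity) :
    t.childNode x i ∈ (toDecomposition ht hv he).sChildren S x ↔ SChild S (t.subAt x) i := by
  have hb := bag_subset_verts ((t.subAt x).child i)
  have hc := verts_child_subset (t.subAt x) i
  have hp : (toDecomposition ht hv he).IsParent x (t.childNode x i) :=
    (toDecomposition_isParent ht hv he).2 ⟨i, rfl⟩
  simp only [RootedTreeDecomposition.sChildren, Set.mem_ofPred_eq, hp, true_and, SChild,
    toDecomposition_traceL, toDecomposition_traceX, toDecomposition_traceR, subAt_childNode]
  apply exists_congr
  intro v
  have := @hb v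
  have := @hc v
  simp only [Set.mem_inter_iff, Set.mem_sdiff, Set.mem_union, Set.mem_compl_iff]
  tauto

theorem toDecomposition_sChildren (S : Set V) (x : t.Nodes) :
    (toDecomposition ht hv he).sChildren S x =
      t.childNode x '' {i | SChild S (t.subAt x) i} := by
  ext y
  constructor
  · intro h
    obtain ⟨i, rfl⟩ := (toDecomposition_isParent ht hv he).1 h.1
    exact ⟨i, (toDecomposition_childNode_mem_sChildren ht hv he S x i).1 h, rfl⟩
  · rintro ⟨i, hi, rfl⟩
    exact (toDecomposition_childNode_mem_sChildren ht hv he S x i).2 hi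

theorem toDecomposition_ncard_sChildren (S : Set V) (x : t.Nodes) :
    ((toDecomposition ht hv he).sChildren S x).ncard = 2 ↔ TwoS S (t.subAt x) := by
  rw [toDecomposition_sChildren, Set.ncard_image_of_injective _ (t.childNode_injective x),
    Set.ncard_eq_two]
  apply exists_congr; intro i
  apply exists_congr; intro j
  simp [Set.ext_iff]

/-- A child with the same trace would have to be an ancestor of `x`. This direction is enough
wherever `Bot` is a hypothesis or is negated, which is how `SlimLocal` uses it. -/
theorem bot_of_isSBottom {S : Set V} {x : t.Nodes}
    (h : (toDecomposition ht hv he).IsSBottom S x) : Bot S (t.subAt x) := by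
  refine ⟨?_, fun i hi => ?_⟩
  · have := h.1
    rwa [toDecomposition_traceL] at this
  · have h2 := h.2 (t.childNode x i) (by
      rw [toDecomposition_trace_eq_iff, subAt_childNode]; exact hi)
    rw [toDecomposition_inSubtree] at h2
    have := h2.suffix.length_le
    simp [childNode] at this

theorem exists_sChild_of_bot {S : Set V} {s : BagTree V} (h : Bot S s) : ∃ i, SChild S s i := by
  obtain ⟨v, ⟨hv, hvb⟩, hvS⟩ := h.1
  rw [verts_eq] at hv
  rcases hv with hv | hv
  · exact absurd hv hvb
  · obtain ⟨i, hi⟩ := Set.mem_iUnion.1 hv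
    exact ⟨i, v, ⟨hi, hvb⟩, hvS⟩

theorem verts_subset_of_desc {x y : t.Nodes} (h : t.Desc x y) :
    (t.subAt y).verts ⊆ (t.subAt x).verts := by
  intro v hv
  rw [mem_verts_iff] at hv ⊢
  obtain ⟨z, hz, hvz⟩ := hv
  exact ⟨z, h.trans hz, hvz⟩

/-- If the paths to `x` and `y` separated at `z`, then `v` would occur below two children of `z`,
hence in the bag of `z`, and would persist along the path down to the bag of `x`. -/
theorem comparable_of_mem (ht : All Valid t) {x y : t.Nodes} {v : V}
    (hvx : v ∈ (t.subAt x).verts \ (t.subAt x).bag)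
    (hvy : v ∈ (t.subAt y).verts \ (t.subAt y).bag) : t.Desc x y ∨ t.Desc y x := by
  have key : ∀ z, t.Desc z x → t.Desc z y → t.Desc x y ∨ t.Desc y x := by
    intro z hzx hzy
    induction hs : t.subAt z using child_induction generalizing z with
    | h s ih =>
      subst hs
      rcases hzx.cases_head with rfl | ⟨_, ⟨i, rfl⟩, hix⟩
      · exact Or.inl hzy
      rcases hzy.cases_head with rfl | ⟨_, ⟨j, rfl⟩, hjy⟩
      · exact Or.inr (.head ⟨i, rfl⟩ hix)
      by_cases hij : i = j
      · subst hij
        exact ih i _ hix hjy (by simp)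
      · exfalso
        have h1 := verts_subset_of_desc hix hvx.1
        have h2 := verts_subset_of_desc hjy hvy.1
        have hz : v ∈ (t.subAt z).bag := by
          apply (ht.subAt z).children i j hij
          rw [← subAt_childNode, ← subAt_childNode]
          exact ⟨h1, h2⟩
        obtain ⟨w, hxw, hw⟩ := (t.mem_verts_iff v x).1 hvx.1
        have hdesc : ∀ a, t.Desc a w → v ∈ (t.subAt a).bag → t.Desc a x →
            v ∈ (t.subAt x).bag := by
          intro a haw ha hax
          induction hax using Relation.ReflTransGen.head_induction_on with
          | refl => exact ha
          | @head a b hab hbx ih =>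
            obtain ⟨k, rfl⟩ := hab
            apply ih (Relation.ReflTransGen.trans hbx hxw)
            have h3 := verts_subset_of_desc hbx hvx.1
            rw [subAt_childNode] at h3 ⊢
            exact (ht.subAt a).child k ⟨h3, ha⟩
        have hzx : t.Desc z x := .head ⟨i, rfl⟩ hix
        exact hvx.2 (hdesc z (hzx.trans hxw) hz hzx)
  exact key _ (t.desc_rootNode x) (t.desc_rootNode y)

/-- A node with the same trace is comparable with `x`. Strictly below `x` it would lie under one
child, yet its subtree would still contain a vertex of $S$ that another $S$-child contributes
outside the bag of `x`, against running intersection. Nodes of full join trees have to be shown to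
be $S$-bottom, for which `Bot` is too weak. -/
theorem isSBottom_of_twoS {S : Set V} {x : t.Nodes} (h : TwoS S (t.subAt x)) :
    (toDecomposition ht hv he).IsSBottom S x := by
  obtain ⟨i, j, hij, hk⟩ := h
  have hex : ∀ k, SChild S (t.subAt x) k →
      ∃ v ∈ (t.subAt (t.childNode x k)).verts, v ∉ (t.subAt x).bag ∧ v ∈ S := by
    rintro k ⟨v, ⟨h1, h2⟩, h3⟩
    exact ⟨v, by simpa using h1, h2, h3⟩
  have hL : ∀ k, (t.subAt (t.childNode x k)).verts ⊆ (t.subAt x).verts := fun k => by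
    rw [subAt_childNode]; exact verts_child_subset _ k
  obtain ⟨v, hvi, hvb, hvS⟩ := hex i ((hk i).2 (Or.inl rfl))
  refine ⟨⟨v, ?_⟩, fun s hs => ?_⟩
  · rw [toDecomposition_traceL]
    exact ⟨⟨hL i hvi, hvb⟩, hvS⟩
  · rw [toDecomposition_trace_eq_iff] at hs
    rw [toDecomposition_inSubtree]
    have hmem : ∀ u ∈ (t.subAt x).verts, u ∉ (t.subAt x).bag → u ∈ S →
        u ∈ (t.subAt s).verts ∧ u ∉ (t.subAt s).bag := by
      intro u hu hub huS
      have h1 := Set.ext_iff.1 hs.1 u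
      have h2 := Set.ext_iff.1 hs.2 u
      simp only [Set.mem_inter_iff, huS, and_true] at h1 h2
      exact ⟨h1.2 hu, fun h => hub (h2.1 h)⟩
    obtain hsx | hxs := comparable_of_mem ht (hmem v (hL i hvi) hvb hvS) ⟨hL i hvi, hvb⟩
    · exact hsx
    rcases hxs.cases_head with rfl | ⟨_, ⟨k, rfl⟩, hks⟩
    · exact .refl
    exfalso
    obtain ⟨k', hk', hkk'⟩ : ∃ k', SChild S (t.subAt x) k' ∧ k ≠ k' := by
      by_cases hki : k = i
      · exact ⟨j, (hk j).2 (Or.inr rfl), hki ▸ hij⟩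
      · exact ⟨i, (hk i).2 (Or.inl rfl), hki⟩
    obtain ⟨u, huk, hub, huS⟩ := hex k' hk'
    have h1 := (hmem u (hL k' huk) hub huS).1
    have h2 := verts_subset_of_desc hks h1
    apply hub
    apply (ht.subAt x).children k k' hkk'
    rw [← subAt_childNode, ← subAt_childNode]
    exact ⟨h2, huk⟩

end Decomposition

end BagTree

/-! ### From the local conditions to nice and slim decompositions -/

namespace BagTree

variable {V : Type*}

theorem All.mono {p q : BagTree V → Prop} (h : ∀ t, p t → q t) :
    ∀ t : BagTree V, All p t → All q t
  | node _ _ cs => fun ht => ⟨h _ ht.1, fun i => All.mono h (cs i) (ht.2 i)⟩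

section Slim

variable {G : SimpleGraph V} {S : Set V} {W : ℕ} {t : BagTree V} (ht : All Valid t)
  (hv : t.verts = Set.univ) (he : ∀ u v, G.Adj u v → InSomeBag u v t)

theorem toDecomposition_isFull (hW : (toDecomposition ht hv he).width = W - 1) (x : t.Nodes) :
    (toDecomposition ht hv he).IsFull x ↔ (t.subAt x).bag.ncard = W := by
  unfold RootedTreeDecomposition.IsFull
  rw [hW, toDecomposition_bag]
  omega

theorem ncard_lt_of_not_isFull (hs : All (SlimLocal G S W) t)
    (hW : (toDecomposition ht hv he).width = W - 1) {x : t.Nodes}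
    (h : ¬ (toDecomposition ht hv he).IsFull x) : (t.subAt x).bag.ncard < W := by
  rw [toDecomposition_isFull ht hv he hW] at h
  have := (hs.subAt x).card_le
  omega

theorem isFull_of_mem (hW : (toDecomposition ht hv he).width = W - 1) {F : Set t.Nodes}
    (hF : (toDecomposition ht hv he).IsFullJoinTree F) {x : t.Nodes} (hx : x ∈ F) :
    (t.subAt x).bag.ncard = W := by
  obtain ⟨-, -, X, hX, hFX⟩ := hF.prop
  have := hFX x hx
  rw [toDecomposition_bag] at this
  rw [this]
  rw [hW] at hX
  omega

theorem bag_eq_of_mem {F : Set t.Nodes} (hF : (toDecomposition ht hv he).IsFullJoinTree F)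
    {x y : t.Nodes} (hx : x ∈ F) (hy : y ∈ F) : (t.subAt x).bag = (t.subAt y).bag := by
  obtain ⟨-, -, X, hX, hFX⟩ := hF.prop
  have h1 := hFX x hx
  have h2 := hFX y hy
  rw [toDecomposition_bag] at h1 h2
  rw [h1, h2]

theorem exists_adj_mem {F : Set t.Nodes} (hF : (toDecomposition ht hv he).IsFullJoinTree F)
    {x : t.Nodes} (hx : x ∈ F) : ∃ y ∈ F, t.graph.Adj x y := by
  obtain ⟨hn, hc, -⟩ := hF.prop
  have : Nontrivial F := hn.coe_sort
  obtain ⟨y, hy⟩ := hc.preconnected.exists_adj_of_nontrivial ⟨x, hx⟩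
  exact ⟨y.1, y.2, hy⟩

/-- By maximality: adding the edge to `F` keeps it connected with one common full bag. -/
theorem mem_of_adj_of_bag_eq {F : Set t.Nodes}
    (hF : (toDecomposition ht hv he).IsFullJoinTree F) {x y : t.Nodes} (hx : x ∈ F)
    (hxy : t.graph.Adj x y) (hb : (t.subAt y).bag = (t.subAt x).bag) : y ∈ F := by
  obtain ⟨hn, hc, X, hX, hFX⟩ := hF.prop
  have hle : F ⊆ F ∪ {x, y} := Set.subset_union_left
  refine hF.le_of_ge ⟨hn.mono hle, ?_, X, hX, ?_⟩ hle (by simp)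
  · have hp := SimpleGraph.induce_pair_connected_of_adj hxy
    refine SimpleGraph.induce_union_connected ?_ ?_ ⟨x, hx, by simp⟩
    · exact hc.preconnected
    · exact hp.preconnected
  · rintro z (hz | rfl | rfl)
    · exact hFX z hz
    · exact hFX z hx
    · rw [toDecomposition_bag, hb]
      exact hFX x hx

theorem exists_isFullJoinTree (hW : (toDecomposition ht hv he).width = W - 1) {x y : t.Nodes}
    (hxy : t.graph.Adj x y) (hx : (t.subAt x).bag.ncard = W)
    (hb : (t.subAt y).bag = (t.subAt x).bag) :
    ∃ F, (toDecomposition ht hv he).IsFullJoinTree F ∧ x ∈ F ∧ y ∈ F := by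
  have hfin : {F' : Set t.Nodes | F'.Nontrivial ∧
      ((toDecomposition ht hv he).tree.induce F').Connected ∧
      ∃ X : Set V, (X.ncard : ℤ) = (toDecomposition ht hv he).width + 1 ∧
        ∀ z ∈ F', (toDecomposition ht hv he).bag z = X}.Finite := Set.toFinite _
  obtain ⟨F, hle, hF⟩ := hfin.exists_le_maximal (a := {x, y}) (by
    refine ⟨Set.nontrivial_pair hxy.ne, SimpleGraph.induce_pair_connected_of_adj hxy,
      (t.subAt x).bag, ?_, ?_⟩
    · rw [hx, hW]; omega
    · rintro z (rfl | rfl)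
      · rfl
      · exact hb)
  exact ⟨F, hF, hle (by simp), hle (by simp)⟩

/-- With a single $S$-child, equal bags on $S$ would give equal traces, so at a bottom node the bags
differ on $S$. Being nested and of almost equal size, they differ in exactly one vertex, which
therefore lies in $S$: an introduce or a forget. Two $S$-children give a join. -/
theorem toDecomposition_isSNice [Finite V] (hs : All (SlimLocal G S W) t) :
    (toDecomposition ht hv he).IsSNice S := by
  constructor
  · intro p c hpc
    obtain ⟨i, rfl⟩ := (toDecomposition_isParent ht hv he).1 hpc
    obtain ⟨h1, h2, h3⟩ := (hs.subAt p).bag_child i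
    simp only [toDecomposition_bag, subAt_childNode]
    exact ⟨h1, by omega, by omega⟩
  · intro x hx
    have hbot := bot_of_isSBottom ht hv he hx
    have hloc := hs.subAt x
    rcases hloc.sChild with h | ⟨⟨i, j, hij, hk⟩, hsub⟩
    · obtain ⟨i, hi⟩ := exists_sChild_of_bot hbot
      have hch : (toDecomposition ht hv he).sChildren S x = {t.childNode x i} := by
        rw [toDecomposition_sChildren]
        have : {j | SChild S (t.subAt x) j} = {i} := by
          ext j
          simp only [Set.mem_ofPred_eq, Set.mem_singleton_iff]
          exact ⟨fun hj => h j i hj hi, fun hj => hj ▸ hi⟩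
        rw [this, Set.image_singleton]
      have hverts : ((t.subAt x).verts ∩ S) ⊆ (t.subAt x).bag ∪ ((t.subAt x).child i).verts := by
        rintro v ⟨hv, hvS⟩
        by_contra hcon
        simp only [Set.mem_union, not_or] at hcon
        rw [verts_eq] at hv
        rcases hv with hv | hv
        · exact hcon.1 hv
        · obtain ⟨j, hj⟩ := Set.mem_iUnion.1 hv
          exact hcon.2 (h j i ⟨v, ⟨hj, hcon.1⟩, hvS⟩ hi ▸ hj)
      have hne : ((t.subAt x).child i).bag ∩ S ≠ (t.subAt x).bag ∩ S := by
        intro heq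
        refine hbot.2 i ⟨?_, heq⟩
        apply subset_antisymm
        · exact Set.inter_subset_inter_left _ (verts_child_subset _ i)
        · intro v hv
          refine ⟨?_, hv.2⟩
          rcases hverts hv with h | h
          · have : v ∈ ((t.subAt x).child i).bag ∩ S := heq ▸ ⟨h, hv.2⟩
            exact bag_subset_verts _ this.1
          · exact h
      obtain ⟨h1, h2, h3⟩ := hloc.bag_child i
      have aux : ∀ A B : Set V, A ⊆ B → B.ncard ≤ A.ncard + 1 → ∀ v ∈ B, v ∉ A →
          B = insert v A := by
        intro A B hAB hcard v hv hvA
        refine (Set.eq_of_subset_of_ncard_le (Set.insert_subset hv hAB) ?_ B.toFinite).symm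
        rw [Set.ncard_insert_of_notMem hvA A.toFinite]
        exact hcard
      rcases h1 with h1 | h1
      · left
        obtain ⟨v, ⟨hvb, hvS⟩, hvc⟩ : ∃ v ∈ (t.subAt x).bag ∩ S, v ∉ ((t.subAt x).child i).bag := by
          by_contra! hcon
          exact hne (subset_antisymm (Set.inter_subset_inter_left _ h1)
            fun v hv => ⟨hcon v hv, hv.2⟩)
        refine ⟨v, t.childNode x i, hch, ⟨hvS, by simpa using hvc⟩, ?_⟩
        simp only [toDecomposition_traceX, subAt_childNode]
        rw [aux _ _ h1 h3 v hvb hvc]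
        ext w
        simp only [Set.mem_inter_iff, Set.mem_insert_iff, Set.mem_union, Set.mem_singleton_iff]
        constructor
        · tauto
        · rintro (h | rfl) <;> tauto
      · right; left
        obtain ⟨v, ⟨hvb, hvS⟩, hvc⟩ : ∃ v ∈ ((t.subAt x).child i).bag ∩ S, v ∉ (t.subAt x).bag := by
          by_contra! hcon
          exact hne (subset_antisymm (fun v hv => ⟨hcon v hv, hv.2⟩)
            (Set.inter_subset_inter_left _ h1))
        refine ⟨v, t.childNode x i, hch, ⟨hvS, by simpa using hvb⟩, ?_⟩
        simp only [toDecomposition_traceX, subAt_childNode]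
        rw [aux _ _ h1 h2 v hvb hvc]
        ext w
        simp only [Set.mem_inter_iff, Set.mem_insert_iff, Set.mem_sdiff, Set.mem_singleton_iff]
        constructor
        · rintro ⟨hw, hwS⟩
          exact ⟨⟨Or.inr hw, hwS⟩, fun h => hvc (h ▸ hw)⟩
        · tauto
    · right; right
      refine ⟨t.childNode x i, t.childNode x j, fun h => hij (t.childNode_injective x h), ?_, ?_⟩
      · rw [toDecomposition_sChildren]
        have : {k | SChild S (t.subAt x) k} = {i, j} := by
          ext k
          simp only [Set.mem_ofPred_eq, hk k]
          rfl
        rw [this, Set.image_pair]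
      · simp only [toDecomposition_traceX, subAt_childNode]
        apply Set.union_subset
        · exact Set.subset_inter (hsub i ((hk i).2 (Or.inl rfl))) Set.inter_subset_right
        · exact Set.subset_inter (hsub j ((hk j).2 (Or.inr rfl))) Set.inter_subset_right

/-- Descending through children with bag `X` never leaves `F`, by maximality; the $S$-child with a
different bag where the descent ends indexes the part. -/
theorem exists_part_of_isPartSet {F : Set t.Nodes}
    (hF : (toDecomposition ht hv he).IsFullJoinTree F) {X : Set V} {x : t.Nodes} (hx : x ∈ F)
    (hX : (t.subAt x).bag = X) {P : Set V} (hP : IsPartSet S X (t.subAt x) P) :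
    ∃ s ∉ F, (∃ y ∈ F, s ∈ (toDecomposition ht hv he).sChildren S y) ∧
      P = (toDecomposition ht hv he).subtreeVerts s ∧ t.Desc x s := by
  generalize hs : t.subAt x = s at hP
  induction hP generalizing x with
  | here s i hi hiX =>
    subst hs
    refine ⟨t.childNode x i, fun hmem => ?_, ⟨x, hx, ?_⟩, ?_, .single ⟨i, rfl⟩⟩
    · have := bag_eq_of_mem ht hv he hF hmem hx
      rw [subAt_childNode, hX] at this
      exact hiX this
    · exact (toDecomposition_childNode_mem_sChildren ht hv he S x i).2 hi
    · rw [toDecomposition_subtreeVerts, subAt_childNode]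
  | there s i P hiX _ ih =>
    subst hs
    have hmem : t.childNode x i ∈ F :=
      mem_of_adj_of_bag_eq ht hv he hF hx (Or.inl ⟨i, rfl⟩) (by rw [subAt_childNode, hX, hiX])
    obtain ⟨s, h1, h2, h3, h4⟩ := ih hmem (by rw [subAt_childNode, hiX]) (subAt_childNode _ _ _)
    exact ⟨s, h1, h2, h3, .head ⟨i, rfl⟩ h4⟩

/-- The root `r` of `F` has a child with the same bag, so `hroot` gives it a parent `q`, whose bag
differs by maximality of `F`. Hence `SlimLocal.parts_child` applies at `q`. -/
theorem exists_three_parts (hs : All (SlimLocal G S W) t)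
    (hW : (toDecomposition ht hv he).width = W - 1)
    (hroot : ∀ i, t.bag.ncard = W → (t.child i).bag ≠ t.bag) {F : Set t.Nodes}
    (hF : (toDecomposition ht hv he).IsFullJoinTree F) {X : Set V}
    (hX : ∀ x ∈ F, (toDecomposition ht hv he).bag x = X) {r : t.Nodes}
    (hr : (toDecomposition ht hv he).IsRootOf F r) {v : V} (hvX : v ∈ X \ S) :
    ∃ (C P : Fin 3 → Set V) (s : Fin 3 → t.Nodes), Function.Injective s ∧
      (∀ i j, i ≠ j → Disjoint (C i) (C j)) ∧
      ∀ i, IsComp G X (C i) ∧ (C i ∩ S).Nonempty ∧ (∃ u ∈ C i, G.Adj v u) ∧ C i ⊆ P i ∧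
        (toDecomposition ht hv he).IsPart S F r (s i) (P i) := by
  obtain ⟨hrF, hrdesc⟩ := hr
  simp only [toDecomposition_inSubtree] at hrdesc
  have hrX : (t.subAt r).bag = X := hX r hrF
  have hrW := isFull_of_mem ht hv he hW hF hrF
  obtain ⟨y, hyF, hry⟩ := exists_adj_mem ht hv he hF hrF
  obtain ⟨i, rfl⟩ : t.Par r y := by
    rcases hry with h | h
    · exact h
    · have h1 := (hrdesc y hyF).suffix.length_le
      have h2 := h.length
      omega
  have hib : ((t.subAt r).child i).bag = (t.subAt r).bag := by
    rw [← subAt_childNode]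
    exact bag_eq_of_mem ht hv he hF hyF hrF
  rcases t.eq_rootNode_or_exists_par r with rfl | ⟨q, hqr⟩
  · exact absurd hib (hroot i hrW)
  have hqF : q ∉ F := fun hq => by
    have h1 := (hrdesc q hq).suffix.length_le
    have h2 := hqr.length
    omega
  have hqb : (t.subAt q).bag ≠ (t.subAt r).bag := fun h =>
    hqF (mem_of_adj_of_bag_eq ht hv he hF hrF (Or.inr hqr) h)
  have hthree : HasThreeParts G S (t.subAt r) := by
    have hex : ∃ i, ((t.subAt r).child i).bag = (t.subAt r).bag := ⟨i, hib⟩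
    obtain ⟨k, hk⟩ := hqr
    have hat : t.subAt r = (t.subAt q).child k := by rw [hk, subAt_childNode]
    rw [hat] at hex hrW hqb ⊢
    exact (hs.subAt q).parts_child k hrW (Ne.symm hqb) hex
  obtain ⟨C, P, hPinj, hCdisj, hC⟩ := hthree v (hrX ▸ hvX)
  rw [hrX] at hC
  have hnode : ∀ i, ∃ s, (toDecomposition ht hv he).IsPart S F r s (P i) ∧
      ((P i = (toDecomposition ht hv he).subtreeVerts s ∧ t.Desc r s) ∨
        (P i = ((t.subAt r).verts)ᶜ ∧ s = q)) := by
    intro i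
    rcases (hC i).2.2.2.2 with h | h
    · obtain ⟨s, h1, h2, h3, h4⟩ := exists_part_of_isPartSet ht hv he hF hrF hrX h
      exact ⟨s, Or.inl ⟨h1, h2, h3⟩, Or.inl ⟨h3, h4⟩⟩
    · refine ⟨q, Or.inr ⟨(toDecomposition_isParent ht hv he).2 hqr, ?_⟩, Or.inr ⟨h, rfl⟩⟩
      rw [toDecomposition_subtreeVerts, h]
  choose s hs1 hs2 using hnode
  have hndesc : ¬ t.Desc r q := fun h => by
    have h1 := h.suffix.length_le
    have h2 := hqr.length
    omega
  -- A node determines its part: parts below belong to descendants of `r`, and `q` is not one.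
  refine ⟨C, P, s, fun i j hij => hPinj ?_, hCdisj, fun i =>
    ⟨(hC i).1, (hC i).2.1, (hC i).2.2.1, (hC i).2.2.2.1, hs1 i⟩⟩
  rcases hs2 i with ⟨h1, h2⟩ | ⟨h1, h2⟩ <;> rcases hs2 j with ⟨h3, h4⟩ | ⟨h3, h4⟩
  · rw [h1, h3, hij]
  · rw [hij, h4] at h2; exact absurd h2 hndesc
  · rw [← hij, h2] at h4; exact absurd h4 hndesc
  · rw [h1, h3]

theorem toDecomposition_isSlim [Finite V] (hs : All (SlimLocal G S W) t)
    (hW : (toDecomposition ht hv he).width = W - 1)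
    (hroot : ∀ i, t.bag.ncard = W → (t.child i).bag ≠ t.bag) (hbot : ¬ Bot S t) :
    (toDecomposition ht hv he).IsSlim S := by
  constructor
  · exact fun h => hbot (bot_of_isSBottom ht hv he h)
  · intro x hx h2
    rw [toDecomposition_ncard_sChildren] at h2
    rcases t.eq_rootNode_or_exists_par x with rfl | ⟨q, i, rfl⟩
    · exact absurd (bot_of_isSBottom ht hv he hx) hbot
    rcases (hs.subAt q).join_child i (by simpa using h2) with ⟨h3, h4 | ⟨j, h4⟩⟩ | ⟨⟨h3, h4⟩, h5⟩
    · left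
      obtain ⟨F, hF, hxF, -⟩ := exists_isFullJoinTree ht hv he hW
        (x := t.childNode q i) (y := q) (Or.inr ⟨i, rfl⟩) (by simpa using h3) (by simpa using h4)
      exact ⟨F, hF, hxF⟩
    · left
      have hat := subAt_childNode t q i
      rw [← hat] at h3
      have : ∃ j, ((t.subAt (t.childNode q i)).child j).bag = (t.subAt (t.childNode q i)).bag := by
        rw [hat]; exact ⟨j, h4⟩
      obtain ⟨j, h4⟩ := this
      obtain ⟨F, hF, hxF, -⟩ := exists_isFullJoinTree ht hv he hW
        (x := t.childNode q i) (y := t.childNode _ j) (Or.inl ⟨j, rfl⟩) h3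
        (by simpa using h4)
      exact ⟨F, hF, hxF⟩
    · right
      have hat := subAt_childNode t q i
      rw [← hat] at h4 h5
      rintro s (hsc | hsp)
      · rw [toDecomposition_sChildren] at hsc
        obtain ⟨j, hj, rfl⟩ := hsc
        obtain ⟨h6, h7⟩ := h5 j hj
        rw [toDecomposition_isFull ht hv he hW, toDecomposition_bag, toDecomposition_bag]
        rw [subAt_childNode]
        exact ⟨by omega, h7⟩
      · have := ((toDecomposition_isParent ht hv he).1 hsp).unique ⟨i, rfl⟩
        subst this
        rw [toDecomposition_isFull ht hv he hW, toDecomposition_bag, toDecomposition_bag]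
        exact ⟨by omega, h4⟩
  · intro x hx hfull p hp
    obtain ⟨i, rfl⟩ := (toDecomposition_isParent ht hv he).1 hp
    have hb := bot_of_isSBottom ht hv he hx
    have hc := ncard_lt_of_not_isFull ht hv he hs hW hfull
    have hat := subAt_childNode t p i
    rw [hat] at hb hc
    obtain ⟨h1, h2⟩ := (hs.subAt p).bot_child i hb hc
    refine ⟨by simpa using h1, ?_⟩
    rw [toDecomposition_sChildren]
    have hi : SChild S (t.subAt p) i := by
      obtain ⟨v, ⟨h3, h4⟩, h5⟩ := hb.1
      exact ⟨v, ⟨h3, h1 ▸ h4⟩, h5⟩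
    have : {j | SChild S (t.subAt p) j} = {i} := by
      ext j
      exact ⟨h2 j, fun h => by rw [Set.mem_singleton_iff.1 h]; exact hi⟩
    rw [this, Set.image_singleton]
  · intro x hx v hvS hforget c hc hfull
    have hb := bot_of_isSBottom ht hv he hx
    obtain ⟨c', hc', hvc, htr⟩ := hforget
    rw [hc', Set.mem_singleton_iff] at hc
    subst hc
    have hmem : c ∈ (toDecomposition ht hv he).sChildren S x := by rw [hc']; rfl
    obtain ⟨i, rfl⟩ := (toDecomposition_isParent ht hv he).1 hmem.1
    have hi := (toDecomposition_childNode_mem_sChildren ht hv he S x i).1 hmem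
    have hcard := ncard_lt_of_not_isFull ht hv he hs hW hfull
    have hat := subAt_childNode t x i
    rw [hat] at hcard
    have hnot : ¬ ((t.subAt x).child i).bag ⊆ (t.subAt x).bag := by
      intro hsub
      rw [toDecomposition_bag, hat] at hvc
      have : v ∈ (toDecomposition ht hv he).traceX S x := ⟨hsub hvc.2, hvS⟩
      rw [htr] at this
      exact this.2 rfl
    obtain ⟨h1, h2⟩ := (hs.subAt x).forget_child hb i hi hcard hnot
    rw [← hat] at h1 h2
    rw [toDecomposition_sChildren]
    constructor
    · rintro _ ⟨j, hj, rfl⟩ _ ⟨k, hk, rfl⟩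
      rw [h1 j k hj hk]
    · rintro _ ⟨j, hj, rfl⟩
      simpa using h2 j hj
  · intro x hx p hp hfull
    obtain ⟨j, rfl⟩ := (toDecomposition_isParent ht hv he).1 hp
    rcases t.eq_rootNode_or_exists_par p with rfl | ⟨q, hqp⟩
    · exact Or.inl rfl
    · right
      intro q' hq'
      have := ((toDecomposition_isParent ht hv he).1 hq').unique hqp
      subst this
      obtain ⟨i, rfl⟩ := hqp
      have hb := bot_of_isSBottom ht hv he hx
      have hcard := ncard_lt_of_not_isFull ht hv he hs hW hfull
      intro hq
      rw [subAt_childNode] at hb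
      have hat := subAt_childNode t q' i
      have key : ∀ s, s = (t.subAt q').child i → ∀ j : Fin s.arity, Bot S (s.child j) →
          s.bag.ncard < W → False := by
        rintro s rfl j hb hc
        exact (hs.subAt q').grandchild i j hb hc (bot_of_isSBottom ht hv he hq)
      exact key _ hat j hb hcard
  · intro F hF x hx
    obtain ⟨y, hyF, hxy⟩ := exists_adj_mem ht hv he hF hx
    have htwo : TwoS S (t.subAt x) := by
      rcases hxy with ⟨i, rfl⟩ | ⟨i, rfl⟩
      · refine ((hs.subAt x).full_child i (isFull_of_mem ht hv he hW hF hx) ?_).1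
        have := bag_eq_of_mem ht hv he hF hyF hx
        rwa [subAt_childNode] at this
      · have h1 := ((hs.subAt y).full_child i (isFull_of_mem ht hv he hW hF hyF) (by
          have := bag_eq_of_mem ht hv he hF hx hyF
          rwa [subAt_childNode] at this)).2
        rwa [subAt_childNode]
    exact ⟨isSBottom_of_twoS ht hv he htwo, (toDecomposition_ncard_sChildren ht hv he S x).2 htwo⟩
  · intro F hF X hX r hr v hvX
    obtain ⟨C, P, s, hsinj, hdisj, h⟩ := exists_three_parts ht hv he hs hW hroot hF hX hr hvX
    choose u huC hvu using fun i => (h i).2.2.1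
    refine ⟨u, s, fun i j hij => ?_, hsinj, fun i => ⟨hvu i, ?_, P i, (h i).2.2.2.2,
      (h i).2.2.2.1 (huC i)⟩⟩
    · by_contra hne
      exact (hdisj i j hne).notMem_of_mem_left (huC i) (hij ▸ huC j)
    · obtain ⟨w, hwC, hwS⟩ := (h i).2.1
      exact ⟨(h i).1.disj.notMem_of_mem_left (huC i), w, (h i).1.disj.notMem_of_mem_left hwC, hwS,
        (h i).1.reachable (huC i) hwC⟩

theorem exists_three_components (hs : All (SlimLocal G S W) t)
    (hW : (toDecomposition ht hv he).width = W - 1)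
    (hroot : ∀ i, t.bag.ncard = W → (t.child i).bag ≠ t.bag) {F : Set t.Nodes}
    (hF : (toDecomposition ht hv he).IsFullJoinTree F) {X : Set V}
    (hX : ∀ x ∈ F, (toDecomposition ht hv he).bag x = X) {r : t.Nodes}
    (hr : (toDecomposition ht hv he).IsRootOf F r) {v : V} (hvX : v ∈ X \ S) :
    ∃ (C : Fin 3 → (G.induce Xᶜ).ConnectedComponent) (s : Fin 3 → t.Nodes),
      Function.Injective C ∧ Function.Injective s ∧
      ∀ i, IsSComponent S (C i) ∧ (∃ u ∈ componentVerts (C i), G.Adj v u) ∧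
        ∃ P : Set V, (toDecomposition ht hv he).IsPart S F r (s i) P ∧
          componentVerts (C i) ⊆ P := by
  obtain ⟨E, P, s, hsinj, hdisj, h⟩ := exists_three_parts ht hv he hs hW hroot hF hX hr hvX
  choose C hC using fun i => (h i).1.exists_connectedComponent
  refine ⟨C, s, fun i j hij => ?_, hsinj, fun i => ?_⟩
  · by_contra hne
    obtain ⟨u, hu⟩ := (h i).1.conn.1
    refine (hdisj i j hne).notMem_of_mem_left hu ?_
    rw [← hC j, ← hij, hC i]
    exact hu
  · unfold IsSComponent
    rw [hC i]
    exact ⟨(h i).2.1, (h i).2.2.1, P i, (h i).2.2.2.2, (h i).2.2.2.1⟩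

end Slim

end BagTree

/-! ### Copied nodes, blocks and pieces with a root bag that is not full -/

namespace BagTree

variable {V : Type*}

/-- A new root with the same bag above the root. -/
def copy (b : BagTree V) : BagTree V := node b.bag 1 fun _ => b

@[simp] theorem bag_copy (b : BagTree V) : b.copy.bag = b.bag := rfl

theorem child_copy (b : BagTree V) (i : Fin b.copy.arity) : b.copy.child i = b := rfl

theorem copy_subsingleton (b : BagTree V) (i j : Fin b.copy.arity) : i = j :=
  Subsingleton.elim (α := Fin 1) i j

theorem verts_copy (b : BagTree V) : b.copy.verts = b.verts := by
  rw [verts_eq]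
  ext v
  simp only [bag_copy, child_copy, Set.mem_union, Set.mem_iUnion]
  constructor
  · rintro (h | ⟨-, h⟩)
    · exact bag_subset_verts b h
    · exact h
  · exact fun h => Or.inr ⟨(0 : Fin 1), h⟩

theorem not_bot_copy (S : Set V) (b : BagTree V) : ¬ Bot S b.copy := fun h =>
  h.2 (0 : Fin 1) (by
    change b.verts ∩ S = b.copy.verts ∩ S ∧ b.bag ∩ S = b.bag ∩ S
    rw [verts_copy]
    exact ⟨rfl, rfl⟩)

theorem not_twoS_copy (S : Set V) (b : BagTree V) : ¬ TwoS S b.copy := by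
  rintro ⟨i, j, hij, -⟩
  exact hij (copy_subsingleton b i j)

/-- A tree whose root bag is not full and agrees with the bags of the two nodes below, both the
root and its child having only one child. -/
def Calm (W : ℕ) (t : BagTree V) : Prop := t.bag.ncard < W ∧ ∃ b : BagTree V, t = b.copy.copy

section Calm

variable {W : ℕ} {t : BagTree V}

theorem Calm.not_bot (h : Calm W t) (S : Set V) : ¬ Bot S t := by
  obtain ⟨-, b, rfl⟩ := h; exact not_bot_copy S _

theorem Calm.not_twoS (h : Calm W t) (S : Set V) : ¬ TwoS S t := by
  obtain ⟨-, b, rfl⟩ := h; exact not_twoS_copy S _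

theorem Calm.not_bot_child (h : Calm W t) (S : Set V) (i : Fin t.arity) :
    ¬ Bot S (t.child i) := by
  obtain ⟨-, b, rfl⟩ := h; exact not_bot_copy S _

theorem Calm.bag_child (h : Calm W t) (i : Fin t.arity) : (t.child i).bag = t.bag := by
  obtain ⟨-, b, rfl⟩ := h; rfl

theorem Calm.subsingleton (h : Calm W t) (i j : Fin t.arity) : i = j := by
  obtain ⟨-, b, rfl⟩ := h; exact copy_subsingleton _ i j

end Calm

variable {G : SimpleGraph V} {S : Set V} {W : ℕ}

/-- Calm children are neither full, nor bottom nodes, nor joins, and their own children are not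
bottom nodes. This voids the conditions that look downwards, except the one on forget nodes, where
the copied bag and the single child suffice. -/
theorem slimLocal_of_calm {q : BagTree V} (hcalm : ∀ i, Calm W (q.child i)) (valid : Valid q)
    (card_le : q.bag.ncard ≤ W)
    (bag_child : ∀ i, ((q.child i).bag ⊆ q.bag ∨ q.bag ⊆ (q.child i).bag) ∧
      (q.child i).bag.ncard ≤ q.bag.ncard + 1 ∧ q.bag.ncard ≤ (q.child i).bag.ncard + 1)
    (sChild : (∀ i j, SChild S q i → SChild S q j → i = j) ∨
      (TwoS S q ∧ ∀ i, SChild S q i → (q.child i).bag ∩ S ⊆ q.bag)) : SlimLocal G S W q where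
  valid := valid
  card_le := card_le
  bag_child := bag_child
  sChild := sChild
  join_child i h := absurd h ((hcalm i).not_twoS S)
  bot_child i h := absurd h ((hcalm i).not_bot S)
  forget_child _ i _ _ _ :=
    ⟨fun j k _ _ => (hcalm i).subsingleton j k, fun j _ => ((hcalm i).bag_child j).symm⟩
  grandchild i j h := absurd h ((hcalm i).not_bot_child S j)
  full_child i h1 h2 := absurd (hcalm i).1 (by rw [h2]; omega)
  parts_child i h := absurd (hcalm i).1 (by omega)

/-- A copy has the trace of its child, so it is not a bottom node. Only the condition on a join at
`b` remains, which is `h2`. -/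
theorem slimLocal_copy {b : BagTree V} (hb : b.bag.ncard < W)
    (h2 : TwoS S b → ∀ j, SChild S b j →
      (b.child j).bag.ncard < W ∧ (b.child j).bag.ncard ≤ b.bag.ncard) :
    SlimLocal G S W b.copy where
  valid := ⟨fun _ _ h => h.2, fun i j hij => absurd (copy_subsingleton b i j) hij⟩
  card_le := hb.le
  bag_child _ := ⟨Or.inl subset_rfl, Nat.le_succ _, Nat.le_succ _⟩
  sChild := Or.inl fun i j _ _ => copy_subsingleton b i j
  join_child _ h := Or.inr ⟨⟨hb, le_rfl⟩, h2 h⟩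
  bot_child i _ _ := ⟨rfl, fun j _ => copy_subsingleton b j i⟩
  forget_child h := absurd h (not_bot_copy S b)
  grandchild _ _ _ _ := not_bot_copy S b
  full_child _ h := absurd hb (by rw [bag_copy] at h; omega)
  parts_child _ _ h := absurd rfl h

/-- `t` is a tree decomposition of `G[X ∪ A]` with root bag `X` that satisfies the local
conditions. -/
structure IsBlock (G : SimpleGraph V) (S : Set V) (W : ℕ) (t : BagTree V) (X A : Set V) :
    Prop where
  bag_eq : t.bag = X
  verts_eq : t.verts = X ∪ A
  disj : Disjoint X A
  covers : ∀ u ∈ t.verts, ∀ v ∈ t.verts, G.Adj u v → InSomeBag u v t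
  slim : All (SlimLocal G S W) t

/-- No vertex of `A` is adjacent to a vertex of `B`. -/
def NonAdj (G : SimpleGraph V) (A B : Set V) : Prop := ∀ a ∈ A, ∀ b ∈ B, ¬ G.Adj a b

theorem NonAdj.symm {A B : Set V} (h : NonAdj G A B) : NonAdj G B A :=
  fun b hb a ha hab => h a ha b hb hab.symm

/-- There is a tree decomposition of `G[Z ∪ A]` with root bag `Z`, not full, that satisfies the
local conditions and can be attached below another node. -/
def Piece (G : SimpleGraph V) (S : Set V) (W : ℕ) (Z A : Set V) : Prop :=
  ∃ t, IsBlock G S W t Z A ∧ Calm W t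

theorem IsBlock.copy {b : BagTree V} {Z A : Set V} (hb : IsBlock G S W b Z A)
    (hZ : Z.ncard < W) (h2 : TwoS S b → ∀ j, SChild S b j →
      (b.child j).bag.ncard < W ∧ (b.child j).bag.ncard ≤ b.bag.ncard) :
    IsBlock G S W b.copy Z A where
  bag_eq := hb.bag_eq
  verts_eq := by rw [verts_copy, hb.verts_eq]
  disj := hb.disj
  covers u hu v hv huv := by
    rw [verts_copy] at hu hv
    rw [inSomeBag_iff]
    exact Or.inr ⟨(0 : Fin 1), hb.covers u hu v hv huv⟩
  slim := by
    rw [all_iff]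
    refine ⟨slimLocal_copy ?_ h2, fun _ => hb.slim⟩
    rw [hb.bag_eq]; exact hZ

/-- Two copies are needed: the lower one is the parent with the same bag that a non-full bottom node
must have, and the upper one keeps the parent of that parent from being a bottom node. -/
theorem IsBlock.piece {b : BagTree V} {Z A : Set V} (hb : IsBlock G S W b Z A)
    (hZ : Z.ncard < W) (h2 : TwoS S b → ∀ j, SChild S b j →
      (b.child j).bag.ncard < W ∧ (b.child j).bag.ncard ≤ b.bag.ncard) : Piece G S W Z A := by
  have h := (hb.copy hZ h2).copy hZ fun h => absurd h (not_twoS_copy S b)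
  exact ⟨_, h, by rw [h.bag_eq]; exact hZ, _, rfl⟩

theorem verts_node_of_isBlock {X : Set V} {n : ℕ} {cs : Fin n → BagTree V} {Z A : Fin n → Set V}
    (h : ∀ i, IsBlock G S W (cs i) (Z i) (A i)) (hZX : ∀ i, Z i ⊆ X) :
    (node X n cs).verts = X ∪ ⋃ i, A i := by
  rw [verts_eq]
  ext v
  simp only [bag_node, child_node, Set.mem_union, Set.mem_iUnion]
  constructor
  · rintro (hv | ⟨i, hi⟩)
    · exact Or.inl hv
    · rw [(h i).verts_eq] at hi
      exact hi.imp (fun h => hZX i h) fun h => ⟨i, h⟩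
  · rintro (hv | ⟨i, hi⟩)
    · exact Or.inl hv
    · exact Or.inr ⟨i, by rw [(h i).verts_eq]; exact Or.inr hi⟩

theorem valid_node_of_isBlock {X : Set V} {n : ℕ} {cs : Fin n → BagTree V} {Z A : Fin n → Set V}
    (h : ∀ i, IsBlock G S W (cs i) (Z i) (A i)) (hZX : ∀ i, Z i ⊆ X)
    (hXA : ∀ i, Disjoint X (A i)) (hAA : ∀ i j, i ≠ j → Disjoint (A i) (A j)) :
    Valid (node X n cs) := by
  constructor
  · rintro i v ⟨hv, hvX⟩
    simp only [child_node] at hv ⊢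
    rw [(h i).verts_eq] at hv
    rw [(h i).bag_eq]
    exact hv.resolve_right ((hXA i).notMem_of_mem_left hvX)
  · rintro i j hij v ⟨hi, hj⟩
    simp only [child_node, bag_node] at hi hj ⊢
    rw [(h i).verts_eq] at hi
    rw [(h j).verts_eq] at hj
    rcases hi with hi | hi
    · exact hZX i hi
    rcases hj with hj | hj
    · exact hZX j hj
    exact absurd hj ((hAA i j hij).notMem_of_mem_left hi)

/-- Attaching blocks below a new root with a larger bag. -/
theorem isBlock_node {X : Set V} {n : ℕ} {cs : Fin n → BagTree V} {Z A : Fin n → Set V}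
    (h : ∀ i, IsBlock G S W (cs i) (Z i) (A i)) (hZX : ∀ i, Z i ⊆ X)
    (hXA : ∀ i, Disjoint X (A i)) (hadjX : ∀ i, NonAdj G (A i) (X \ Z i))
    (hadj : ∀ i j, i ≠ j → NonAdj G (A i) (A j))
    (hlocal : SlimLocal G S W (node X n cs)) :
    IsBlock G S W (node X n cs) X (⋃ i, A i) where
  bag_eq := rfl
  verts_eq := verts_node_of_isBlock h hZX
  disj := Set.disjoint_iUnion_right.2 hXA
  covers := by
    have key : ∀ i, ∀ u ∈ A i, ∀ v, v ∈ X ∪ ⋃ i, A i → G.Adj u v →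
        InSomeBag u v (cs i) ∧ InSomeBag v u (cs i) := by
      intro i u hu v hv huv
      have hvi : v ∈ (cs i).verts := by
        rw [(h i).verts_eq]
        rcases hv with hv | hv
        · by_contra hcon
          exact hadjX i u hu v ⟨hv, fun h => hcon (Or.inl h)⟩ huv
        · obtain ⟨j, hj⟩ := Set.mem_iUnion.1 hv
          by_cases hij : i = j
          · subst hij; exact Or.inr hj
          · exact absurd huv (hadj i j hij u hu v hj)
      have hui : u ∈ (cs i).verts := by rw [(h i).verts_eq]; exact Or.inr hu
      exact ⟨(h i).covers u hui v hvi huv, (h i).covers v hvi u hui huv.symm⟩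
    intro u hu v hv huv
    rw [verts_node_of_isBlock h hZX] at hu hv
    rw [inSomeBag_iff]
    by_cases hu' : u ∈ X
    · by_cases hv' : v ∈ X
      · exact Or.inl ⟨hu', hv'⟩
      · obtain ⟨i, hi⟩ := Set.mem_iUnion.1 (hv.resolve_left hv')
        exact Or.inr ⟨i, (key i v hi u hu huv.symm).2⟩
    · obtain ⟨i, hi⟩ := Set.mem_iUnion.1 (hu.resolve_left hu')
      exact Or.inr ⟨i, (key i u hi v hv huv).1⟩
  slim := (all_iff _ _).2 ⟨hlocal, fun i => (h i).slim⟩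

/-- Attaching a block below a new root with a smaller bag. -/
theorem isBlock_node_of_subset {X Z A : Set V} {t : BagTree V} (h : IsBlock G S W t X A)
    (hZX : Z ⊆ X) (hlocal : Valid (node Z 1 fun _ => t) → SlimLocal G S W (node Z 1 fun _ => t)) :
    IsBlock G S W (node Z 1 fun _ => t) Z (A ∪ X \ Z) := by
  have hverts : (node Z 1 fun _ => t).verts = t.verts := by
    rw [BagTree.verts_eq]
    ext v
    simp only [bag_node, child_node, Set.mem_union, Set.mem_iUnion]
    constructor
    · rintro (hv | ⟨-, hv⟩)
      · rw [h.verts_eq]; exact Or.inl (hZX hv)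
      · exact hv
    · exact fun hv => Or.inr ⟨(0 : Fin 1), hv⟩
  constructor
  · rfl
  · rw [hverts, h.verts_eq]
    ext v
    have := @hZX v
    simp only [Set.mem_union, Set.mem_sdiff]
    tauto
  · rw [Set.disjoint_union_right]
    exact ⟨h.disj.mono_left hZX, Set.disjoint_sdiff_right⟩
  · intro u hu v hv huv
    rw [hverts] at hu hv
    rw [inSomeBag_iff]
    exact Or.inr ⟨(0 : Fin 1), h.covers u hu v hv huv⟩
  · rw [all_iff]
    refine ⟨hlocal ⟨fun i v hv => ?_, fun i j hij => absurd (Subsingleton.elim (α := Fin 1) i j) hij⟩,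
      fun _ => h.slim⟩
    change v ∈ t.bag
    rw [h.bag_eq]
    exact hZX hv.2

theorem Piece.ncard_lt {Z A : Set V} (h : Piece G S W Z A) : Z.ncard < W := by
  obtain ⟨t, ht, hc⟩ := h
  rw [← ht.bag_eq]; exact hc.1

theorem piece_empty {Z : Set V} (hZ : Z.ncard < W) : Piece G S W Z ∅ := by
  have h := isBlock_node (G := G) (S := S) (W := W) (X := Z) (n := 0) (cs := Fin.elim0)
    (Z := Fin.elim0) (A := Fin.elim0) (fun i => i.elim0) (fun i => i.elim0) (fun i => i.elim0)
    (fun i => i.elim0) (fun i => i.elim0)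
    (slimLocal_of_calm (fun i => i.elim0) ⟨fun i => i.elim0, fun i => i.elim0⟩ hZ.le
      (fun i => i.elim0) (Or.inl fun i => i.elim0))
  rw [Set.iUnion_of_empty] at h
  exact h.piece hZ fun _ j => j.elim0

/-- A join between equal bags that are not full satisfies the second alternative of the join
condition, so any number of pieces over `Z` can be combined pairwise. -/
theorem piece_union {Z A B : Set V} (hA : Piece G S W Z A) (hB : Piece G S W Z B)
    (hAB : Disjoint A B) (hadj : NonAdj G A B) : Piece G S W Z (A ∪ B) := by
  have hZ := hA.ncard_lt
  obtain ⟨s, hs, hsc⟩ := hA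
  obtain ⟨t, ht, htc⟩ := hB
  have hblock : ∀ i, IsBlock G S W (![s, t] i) (![Z, Z] i) (![A, B] i) := by
    rw [Fin.forall_fin_two]; exact ⟨hs, ht⟩
  have hZ' : ∀ i, (![Z, Z] : Fin 2 → Set V) i = Z := by
    rw [Fin.forall_fin_two]; exact ⟨rfl, rfl⟩
  have hcalm : ∀ i, Calm W (![s, t] i) := by
    rw [Fin.forall_fin_two]; exact ⟨hsc, htc⟩
  have hdisj : ∀ i, Disjoint Z (![A, B] i) := by
    rw [Fin.forall_fin_two]; exact ⟨hs.disj, ht.disj⟩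
  have hbag : ∀ i, (![s, t] i).bag = Z := fun i => by rw [(hblock i).bag_eq, hZ']
  have h := isBlock_node (X := Z) hblock (fun i => (hZ' i).le) hdisj
    (fun i a _ b hb => absurd hb.1 (by rw [hZ' i] at hb; exact absurd hb.1 hb.2))
    (by simp only [Fin.forall_fin_two]; exact ⟨⟨fun h => absurd rfl h, fun _ => hadj⟩, fun _ => hadj.symm, fun h => absurd rfl h⟩)
    (slimLocal_of_calm hcalm (valid_node_of_isBlock hblock (fun i => (hZ' i).le) hdisj
      (by simp only [Fin.forall_fin_two]; exact ⟨⟨fun h => absurd rfl h, fun _ => hAB⟩, fun _ => hAB.symm, fun h => absurd rfl h⟩)) hZ.le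
      (fun i => by
        simp only [child_node, bag_node, hbag i]
        exact ⟨Or.inl subset_rfl, Nat.le_succ _, Nat.le_succ _⟩)
      (by
        by_cases h2 : ∀ i : Fin 2, SChild S (node Z 2 ![s, t]) i
        · right
          refine ⟨⟨(0 : Fin 2), (1 : Fin 2), by simp, fun k => ?_⟩, fun i _ => ?_⟩
          · simp only [h2 k, true_iff]
            change Fin 2 at k
            fin_cases k <;> simp
          · simp only [child_node, bag_node, hbag i]
            exact Set.inter_subset_left
        · left
          intro i j hi hj
          change Fin 2 at i j
          by_contra hij
          refine h2 fun k => ?_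
          have : k = i ∨ k = j := by omega
          rcases this with rfl | rfl <;> assumption))
  have hU : ⋃ i, (![A, B] : Fin 2 → Set V) i = A ∪ B := by
    ext v; simp
  rw [hU] at h
  refine h.piece hZ fun _ j _ => ?_
  simp only [child_node, bag_node, hbag j]
  exact ⟨hZ, le_rfl⟩

end BagTree

/-! ### Changing the bag of a piece; full bags and full join trees -/

namespace BagTree

variable {V : Type*} {G : SimpleGraph V} {S : Set V} {W : ℕ}

theorem piece_insert [Finite V] {Z A : Set V} {v : V} (h : Piece G S W Z A) (hvZ : v ∉ Z) (hvA : v ∉ A)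
    (hcard : (insert v Z).ncard < W) (hadj : NonAdj G A {v}) : Piece G S W (insert v Z) A := by
  obtain ⟨t, ht, hc⟩ := h
  have hZX : Z ⊆ insert v Z := Set.subset_insert v Z
  have hdisj : Disjoint (insert v Z) A := Set.disjoint_insert_left.2 ⟨hvA, ht.disj⟩
  have hcard' := Set.ncard_insert_of_notMem hvZ Z.toFinite
  have hb := isBlock_node (X := insert v Z) (n := 1) (cs := fun _ => t) (Z := fun _ => Z)
    (A := fun _ => A) (fun _ => ht) (fun _ => hZX) (fun _ => hdisj)
    (fun _ a ha b hb => hadj a ha b (hb.1.resolve_right hb.2))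
    (fun i j hij => absurd (Subsingleton.elim i j) hij)
    (slimLocal_of_calm (fun _ => hc) (valid_node_of_isBlock (fun _ => ht) (fun _ => hZX)
      (fun _ => hdisj) (fun i j hij => absurd (Subsingleton.elim i j) hij)) hcard.le
      (fun _ => by
        simp only [child_node, bag_node, ht.bag_eq]
        exact ⟨Or.inl hZX, by omega, by omega⟩)
      (Or.inl fun i j _ _ => Subsingleton.elim (α := Fin 1) i j))
  rw [Set.iUnion_const] at hb
  refine hb.piece hcard ?_
  rintro ⟨i, j, hij, -⟩
  exact absurd (Subsingleton.elim (α := Fin 1) i j) hij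

/-- Vertices are added one at a time because neighboring bags may differ in only one vertex. -/
theorem Piece.mono_bag [Finite V] {Z Z' A : Set V} (h : Piece G S W Z A) (hZ : Z ⊆ Z') (hcard : Z'.ncard < W)
    (hdisj : Disjoint Z' A) (hadj : NonAdj G A (Z' \ Z)) : Piece G S W Z' A := by
  induction hn : (Z' \ Z).ncard generalizing Z with
  | zero =>
    have := (Set.ncard_eq_zero (Set.toFinite _)).1 hn
    rwa [subset_antisymm hZ (Set.sdiff_eq_empty.1 this)] at h
  | succ n ih =>
    obtain ⟨v, hv⟩ : (Z' \ Z).Nonempty := Set.nonempty_of_ncard_ne_zero (by omega)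
    have hsub : insert v Z ⊆ Z' := Set.insert_subset hv.1 hZ
    have heq : Z' \ insert v Z = (Z' \ Z) \ {v} := by
      ext w; simp only [Set.mem_sdiff, Set.mem_insert_iff, Set.mem_singleton_iff]; tauto
    refine ih (piece_insert h hv.2 (hdisj.notMem_of_mem_left hv.1)
      ((Set.ncard_le_ncard hsub Z'.toFinite).trans_lt hcard)
      fun a ha b hb => hadj a ha b (Set.mem_singleton_iff.1 hb ▸ hv)) hsub
      (fun a ha b hb => hadj a ha b (by rw [heq] at hb; exact hb.1)) ?_
    rw [heq, Set.ncard_sdiff_singleton_of_mem hv, hn]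
    rfl

theorem piece_sdiff_singleton {Z A : Set V} {v : V} (h : Piece G S W Z A) (hv : v ∈ Z) :
    Piece G S W (Z \ {v}) (A ∪ {v}) := by
  have hlt := h.ncard_lt
  obtain ⟨t, ht, hc⟩ := h
  have hcard := Set.ncard_sdiff_singleton_of_mem hv
  have hb := isBlock_node_of_subset (Z := Z \ {v}) ht Set.sdiff_subset (fun hvalid =>
    slimLocal_of_calm (fun _ => hc) hvalid (by rw [bag_node]; omega)
      (fun _ => by
        simp only [child_node, bag_node, ht.bag_eq]
        exact ⟨Or.inr Set.sdiff_subset, by omega, by omega⟩)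
      (Or.inl fun i j _ _ => Subsingleton.elim (α := Fin 1) i j))
  rw [Set.sdiff_sdiff_right_self, Set.inter_eq_self_of_subset_right
    (Set.singleton_subset_iff.2 hv)] at hb
  refine hb.piece (by omega) ?_
  rintro ⟨i, j, hij, -⟩
  exact absurd (Subsingleton.elim (α := Fin 1) i j) hij

/-- Forgotten vertices move from the bag into the part below, again one at a time. -/
theorem Piece.anti_bag [Finite V] {Z Z' A : Set V} (h : Piece G S W Z A) (hZ : Z' ⊆ Z) :
    Piece G S W Z' (A ∪ Z \ Z') := by
  induction hn : (Z \ Z').ncard generalizing Z A with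
  | zero =>
    have := (Set.ncard_eq_zero (Set.toFinite _)).1 hn
    rw [this, Set.union_empty]
    rwa [subset_antisymm (Set.sdiff_eq_empty.1 this) hZ] at h
  | succ n ih =>
    obtain ⟨v, hv⟩ : (Z \ Z').Nonempty := Set.nonempty_of_ncard_ne_zero (by omega)
    have heq : (Z \ {v}) \ Z' = (Z \ Z') \ {v} := by
      ext w; simp only [Set.mem_sdiff, Set.mem_singleton_iff]; tauto
    have := ih (piece_sdiff_singleton h hv.1)
      (fun w hw => ⟨hZ hw, fun h => hv.2 (Set.mem_singleton_iff.1 h ▸ hw)⟩)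
      (by rw [heq, Set.ncard_sdiff_singleton_of_mem hv, hn]; rfl)
    rw [heq, Set.union_assoc, Set.singleton_union, Set.insert_sdiff_singleton,
      Set.insert_eq_of_mem hv] at this
    exact this

/-- There is a tree decomposition of `G[X ∪ A]` with full root bag `X` that satisfies the local
conditions and can be attached below a node with a smaller bag. -/
def FullPiece (G : SimpleGraph V) (S : Set V) (W : ℕ) (X A : Set V) : Prop :=
  ∃ t, IsBlock G S W t X A ∧
    ((∃ j, (t.child j).bag = X) ∨ ∀ j, Calm W (t.child j)) ∧
    ((∃ j, (t.child j).bag = X) → HasThreeParts G S t)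

/-- Forgetting `w` yields a parent with a bag that is not full. If the full node has a child with
bag `X`, it is the top of a full join tree, for which the three parts are available. Otherwise its
children are calm, and the parent and all $S$-children of a possible join have smaller bags. -/
theorem FullPiece.piece [Finite V] {X A : Set V} (hX : X.ncard = W) (h : FullPiece G S W X A) {w : V}
    (hw : w ∈ X) : Piece G S W (X \ {w}) (A ∪ {w}) := by
  obtain ⟨t, ht, hj, hp⟩ := h
  have hcard := Set.ncard_sdiff_singleton_of_mem hw
  have hpos := (Set.ncard_pos X.toFinite).2 ⟨w, hw⟩
  have hne : X ≠ X \ {w} := fun h => (h ▸ hw : w ∈ X \ {w}).2 rfl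
  have hb := isBlock_node_of_subset (Z := X \ {w}) ht Set.sdiff_subset (fun hvalid =>
    { valid := hvalid
      card_le := by rw [bag_node]; omega
      bag_child := fun _ => by
        simp only [child_node, bag_node, ht.bag_eq]
        exact ⟨Or.inr Set.sdiff_subset, by omega, by omega⟩
      sChild := Or.inl fun i j _ _ => Subsingleton.elim (α := Fin 1) i j
      join_child := fun i _ => by
        simp only [child_node, bag_node, ht.bag_eq]
        rcases hj with hj | hj
        · exact Or.inl ⟨hX, Or.inr hj⟩
        · refine Or.inr ⟨by omega, fun j _ => ⟨(hj j).1, ?_⟩⟩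
          have := (hj j).1
          omega
      bot_child := fun i _ h => by
        simp only [child_node, ht.bag_eq] at h
        omega
      forget_child := fun _ i _ h => by
        simp only [child_node, ht.bag_eq] at h
        omega
      grandchild := fun i _ _ h => by
        simp only [child_node, ht.bag_eq] at h
        omega
      full_child := fun i h => by
        simp only [bag_node] at h
        omega
      parts_child := fun i _ _ h => hp (by
        simp only [child_node, ht.bag_eq] at h
        exact h) })
  rw [Set.sdiff_sdiff_right_self, Set.inter_eq_self_of_subset_right
    (Set.singleton_subset_iff.2 hw)] at hb
  refine hb.piece (by omega) ?_
  rintro ⟨i, j, hij, -⟩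
  exact absurd (Subsingleton.elim (α := Fin 1) i j) hij

/-- The sets in `𝒜` can be attached to a node with full bag `X`, each through a smaller bag. -/
structure Attachable (G : SimpleGraph V) (S : Set V) (W : ℕ) (X : Set V) (𝒜 : Set (Set V)) :
    Prop where
  attach : ∀ A ∈ 𝒜, Disjoint X A ∧ ∃ w ∈ X, Piece G S W (X \ {w}) A ∧ NonAdj G A {w}
  disj : ∀ A ∈ 𝒜, ∀ B ∈ 𝒜, A ≠ B → Disjoint A B
  nonadj : ∀ A ∈ 𝒜, ∀ B ∈ 𝒜, A ≠ B → NonAdj G A B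

theorem Attachable.mono {X : Set V} {𝒜 ℬ : Set (Set V)} (h : Attachable G S W X 𝒜)
    (hsub : ℬ ⊆ 𝒜) : Attachable G S W X ℬ where
  attach A hA := h.attach A (hsub hA)
  disj A hA B hB := h.disj A (hsub hA) B (hsub hB)
  nonadj A hA B hB := h.nonadj A (hsub hA) B (hsub hB)

theorem sChild_iff_of_isBlock {X Z A : Set V} {q : BagTree V} (hq : q.bag = X) (i : Fin q.arity)
    (h : IsBlock G S W (q.child i) Z A) (hZ : Z ⊆ X) (hA : Disjoint X A) :
    SChild S q i ↔ (A ∩ S).Nonempty := by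
  unfold SChild
  rw [hq, h.verts_eq]
  apply exists_congr
  intro v
  have h1 := @hZ v
  have h2 : v ∈ A → v ∉ X := fun hv => hA.notMem_of_mem_right hv
  simp only [Set.mem_inter_iff, Set.mem_sdiff, Set.mem_union]
  tauto

/-- A single node with bag `X` carries all members of `𝒜` as children; those without vertices of `S`
are not $S$-children, so at most two $S$-children occur. Every child bag omits a vertex of `X`, so
no full join tree starts here. -/
theorem exists_isBlock_of_ncard_le_two [Finite V] {X : Set V} {𝒜 : Set (Set V)} (hX : X.ncard = W)
    (h : Attachable G S W X 𝒜) (h2 : {A ∈ 𝒜 | (A ∩ S).Nonempty}.ncard ≤ 2) :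
    ∃ t, IsBlock G S W t X (⋃₀ 𝒜) ∧ (∀ j, Calm W (t.child j)) ∧
      ({A ∈ 𝒜 | (A ∩ S).Nonempty}.ncard = 2 → TwoS S t) ∧
      ∀ A ∈ 𝒜, (A ∩ S).Nonempty → ∃ P, IsPartSet S X t P ∧ A ⊆ P ∧ P ⊆ X ∪ A := by
  obtain ⟨n, ⟨e⟩⟩ := Finite.exists_equiv_fin 𝒜
  let A : Fin n → Set V := fun i => (e.symm i).1
  have hA : ∀ i, A i ∈ 𝒜 := fun i => (e.symm i).2
  have hAinj : Function.Injective A := Subtype.val_injective.comp e.symm.injective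
  have hAsurj : ∀ B ∈ 𝒜, ∃ i, A i = B := fun B hB => ⟨e ⟨B, hB⟩, by simp [A]⟩
  choose hdisj w hwX hpiece hadj using fun i => h.attach (A i) (hA i)
  choose cs hcs hcalm using hpiece
  have hZX : ∀ i, X \ {w i} ⊆ X := fun i => Set.sdiff_subset
  have hAA : ∀ i j, i ≠ j → Disjoint (A i) (A j) := fun i j hij =>
    h.disj _ (hA i) _ (hA j) (hAinj.ne hij)
  have hSC : ∀ i : Fin n, SChild S (node X n cs) i ↔ (A i ∩ S).Nonempty := fun i =>
    sChild_iff_of_isBlock (q := node X n cs) rfl i (hcs i) (hZX i) (hdisj i)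
  have himage : {B ∈ 𝒜 | (B ∩ S).Nonempty} = A '' {i | (A i ∩ S).Nonempty} := by
    ext B
    constructor
    · rintro ⟨hB, hBS⟩
      obtain ⟨i, rfl⟩ := hAsurj B hB
      exact ⟨i, hBS, rfl⟩
    · rintro ⟨i, hi, rfl⟩
      exact ⟨hA i, hi⟩
  rw [himage, Set.ncard_image_of_injective _ hAinj] at h2 ⊢
  have htwo : ∀ i j, i ≠ j → (A i ∩ S).Nonempty → (A j ∩ S).Nonempty →
      TwoS S (node X n cs) := by
    intro i j hij hi hj
    have : {i, j} = {i | (A i ∩ S).Nonempty} := by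
      apply Set.eq_of_subset_of_ncard_le
      · rintro k (rfl | rfl) <;> assumption
      · rw [Set.ncard_pair hij]; exact h2
      · exact Set.toFinite _
    refine ⟨i, j, hij, fun k => ?_⟩
    rw [hSC k]
    exact (Set.ext_iff.1 this k).symm
  have hvalid := valid_node_of_isBlock hcs hZX hdisj hAA
  have hblock := isBlock_node hcs hZX hdisj
    (fun i a ha b hb => hadj i a ha b (by
      by_contra hcon
      exact hb.2 ⟨hb.1, hcon⟩))
    (fun i j hij => h.nonadj _ (hA i) _ (hA j) (hAinj.ne hij))
    (slimLocal_of_calm hcalm hvalid hX.le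
      (fun i => by
        simp only [child_node, bag_node, (hcs i).bag_eq]
        have h1 := Set.ncard_sdiff_singleton_of_mem (hwX i)
        have h2 := Set.ncard_le_ncard (hZX i) X.toFinite
        exact ⟨Or.inl (hZX i), by omega, by omega⟩)
      (by
        by_cases hone : ∀ i j, SChild S (node X n cs) i → SChild S (node X n cs) j → i = j
        · exact Or.inl hone
        · right
          push Not at hone
          obtain ⟨i, j, hi, hj, hij⟩ := hone
          refine ⟨htwo i j hij ((hSC i).1 hi) ((hSC j).1 hj), fun k _ => ?_⟩
          simp only [child_node, bag_node, (hcs k).bag_eq]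
          exact Set.inter_subset_left.trans (hZX k)))
  refine ⟨node X n cs, ?_, hcalm, ?_, ?_⟩
  · have : ⋃₀ 𝒜 = ⋃ i, A i := by
      ext v
      simp only [Set.mem_sUnion, Set.mem_iUnion]
      constructor
      · rintro ⟨B, hB, hv⟩
        obtain ⟨i, rfl⟩ := hAsurj B hB
        exact ⟨i, hv⟩
      · rintro ⟨i, hv⟩
        exact ⟨A i, hA i, hv⟩
    rw [this]
    exact hblock
  · intro h3
    obtain ⟨i, j, hij, hset⟩ := Set.ncard_eq_two.1 h3
    have hi : i ∈ {i | (A i ∩ S).Nonempty} := by rw [hset]; simp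
    have hj : j ∈ {i | (A i ∩ S).Nonempty} := by rw [hset]; simp
    exact htwo i j hij hi hj
  · intro B hB hBS
    obtain ⟨i, rfl⟩ := hAsurj B hB
    refine ⟨(cs i).verts, .here (node X n cs) i ((hSC i).2 hBS) ?_, ?_, ?_⟩
    · simp only [child_node, (hcs i).bag_eq]
      exact fun h => absurd (hwX i) (by rw [← h]; simp)
    · rw [(hcs i).verts_eq]; exact Set.subset_union_right
    · rw [(hcs i).verts_eq]; exact Set.union_subset_union_left _ (hZX i)

/-- A path of nodes with bag `X`: each splits off one member meeting `S` and has the rest of the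
path as its second $S$-child. The last node takes the final two such members and all those that
avoid `S`. The bound `P ⊆ X ∪ A` later makes parts of different members distinct. -/
theorem exists_isBlock_join [Finite V] {X : Set V} {𝒜 : Set (Set V)} (hX : X.ncard = W)
    (h : Attachable G S W X 𝒜) (h2 : 2 ≤ {A ∈ 𝒜 | (A ∩ S).Nonempty}.ncard) :
    ∃ t, IsBlock G S W t X (⋃₀ 𝒜) ∧
      ((∃ j, (t.child j).bag = X) ∨ ∀ j, Calm W (t.child j)) ∧ TwoS S t ∧
      ∀ A ∈ 𝒜, (A ∩ S).Nonempty → ∃ P, IsPartSet S X t P ∧ A ⊆ P ∧ P ⊆ X ∪ A := by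
  induction hn : {A ∈ 𝒜 | (A ∩ S).Nonempty}.ncard using Nat.strong_induction_on
    generalizing 𝒜 with
  | h n ih =>
    rcases eq_or_lt_of_le h2 with h2' | h2'
    · obtain ⟨t, h3, h4, h5, h6⟩ := exists_isBlock_of_ncard_le_two hX h h2'.symm.le
      exact ⟨t, h3, Or.inr h4, h5 h2'.symm, h6⟩
    -- At least three members meet `S`; after removing one of them, at least two remain, so the
    -- shorter path still meets `S` below `X`.
    obtain ⟨A, hA, hAS⟩ : {A ∈ 𝒜 | (A ∩ S).Nonempty}.Nonempty :=
      Set.nonempty_of_ncard_ne_zero (by omega)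
    have hfam : {B ∈ 𝒜 \ {A} | (B ∩ S).Nonempty} = {B ∈ 𝒜 | (B ∩ S).Nonempty} \ {A} := by
      ext B; simp only [Set.mem_sdiff, Set.mem_ofPred_eq]; tauto
    have hcard : {B ∈ 𝒜 \ {A} | (B ∩ S).Nonempty}.ncard + 1 = n := by
      rw [hfam, Set.ncard_sdiff_singleton_of_mem
        (show A ∈ {B ∈ 𝒜 | (B ∩ S).Nonempty} from ⟨hA, hAS⟩)]
      omega
    obtain ⟨f, hf, hfj, hf2, hfparts⟩ := ih _ (by omega)
      (h.mono (ℬ := 𝒜 \ {A}) Set.sdiff_subset) (by omega) rfl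
    obtain ⟨hAX, w, hwX, ⟨a, ha, hac⟩, hadjw⟩ := h.attach A hA
    have hUX : Disjoint X (⋃₀ (𝒜 \ {A})) := Set.disjoint_sUnion_right.2
      fun B hB => (h.attach B hB.1).1
    have hUA : Disjoint A (⋃₀ (𝒜 \ {A})) := Set.disjoint_sUnion_right.2
      fun B hB => h.disj A hA B hB.1 (Ne.symm hB.2)
    have hnon : NonAdj G A (⋃₀ (𝒜 \ {A})) := by
      rintro a ha b ⟨B, hB, hbB⟩
      exact h.nonadj A hA B hB.1 (Ne.symm hB.2) a ha b hbB
    have hlt := hac.1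
    rw [ha.bag_eq] at hlt
    have hcardX := Set.ncard_sdiff_singleton_of_mem hwX
    have hne : X \ {w} ≠ X := fun h => absurd hwX (by rw [← h]; simp)
    have hblocks : ∀ i, IsBlock G S W (![a, f] i) (![X \ {w}, X] i) (![A, ⋃₀ (𝒜 \ {A})] i) := by
      rw [Fin.forall_fin_two]; exact ⟨ha, hf⟩
    have hZX : ∀ i, (![X \ {w}, X] : Fin 2 → Set V) i ⊆ X := by
      rw [Fin.forall_fin_two]; exact ⟨Set.sdiff_subset, subset_rfl⟩
    have hXA : ∀ i, Disjoint X ((![A, ⋃₀ (𝒜 \ {A})] : Fin 2 → Set V) i) := by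
      rw [Fin.forall_fin_two]; exact ⟨hAX, hUX⟩
    have hAA : ∀ i j, i ≠ j → Disjoint ((![A, ⋃₀ (𝒜 \ {A})] : Fin 2 → Set V) i)
        ((![A, ⋃₀ (𝒜 \ {A})] : Fin 2 → Set V) j) := by
      simp only [Fin.forall_fin_two]
      exact ⟨⟨fun h => absurd rfl h, fun _ => hUA⟩, fun _ => hUA.symm, fun h => absurd rfl h⟩
    have hadjX : ∀ i, NonAdj G ((![A, ⋃₀ (𝒜 \ {A})] : Fin 2 → Set V) i)
        (X \ (![X \ {w}, X] : Fin 2 → Set V) i) := by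
      rw [Fin.forall_fin_two]
      exact ⟨fun a ha b hb => hadjw a ha b (by
          by_contra hcon
          exact hb.2 ⟨hb.1, hcon⟩),
        fun a _ b hb => absurd hb.1 hb.2⟩
    have hadj : ∀ i j, i ≠ j → NonAdj G ((![A, ⋃₀ (𝒜 \ {A})] : Fin 2 → Set V) i)
        ((![A, ⋃₀ (𝒜 \ {A})] : Fin 2 → Set V) j) := by
      simp only [Fin.forall_fin_two]
      exact ⟨⟨fun h => absurd rfl h, fun _ => hnon⟩, fun _ => hnon.symm, fun h => absurd rfl h⟩
    have hUS : ((⋃₀ (𝒜 \ {A})) ∩ S).Nonempty := by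
      obtain ⟨B, hB, v, hvB, hvS⟩ : {B ∈ 𝒜 \ {A} | (B ∩ S).Nonempty}.Nonempty :=
        Set.nonempty_of_ncard_ne_zero (by omega)
      exact ⟨v, ⟨B, hB, hvB⟩, hvS⟩
    have hSC : ∀ i : Fin 2, SChild S (node X 2 ![a, f]) i := by
      intro i
      rw [sChild_iff_of_isBlock (q := node X 2 ![a, f]) rfl i (hblocks i) (hZX i) (hXA i)]
      revert i
      rw [Fin.forall_fin_two]
      exact ⟨hAS, hUS⟩
    have htwo : TwoS S (node X 2 ![a, f]) := by
      refine ⟨(0 : Fin 2), (1 : Fin 2), by simp, fun k => ?_⟩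
      simp only [hSC k, true_iff]
      change Fin 2 at k
      fin_cases k <;> simp
    have hlocal : SlimLocal G S W (node X 2 ![a, f]) := by
      refine ⟨valid_node_of_isBlock hblocks hZX hXA hAA, hX.le, ?_, Or.inr ⟨htwo, ?_⟩, ?_, ?_,
        ?_, ?_, ?_, ?_⟩
      · intro i
        change Fin 2 at i
        simp only [child_node, bag_node, (hblocks i).bag_eq]
        refine ⟨Or.inl (hZX i), ?_⟩
        revert i
        rw [Fin.forall_fin_two]
        exact ⟨⟨show (X \ {w}).ncard ≤ _ by omega, show _ ≤ (X \ {w}).ncard + 1 by omega⟩,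
          Nat.le_succ _, Nat.le_succ _⟩
      · intro i _
        simp only [child_node, bag_node, (hblocks i).bag_eq]
        exact Set.inter_subset_left.trans (hZX i)
      · intro i hi
        change Fin 2 at i
        revert i
        rw [Fin.forall_fin_two]
        refine ⟨fun h => absurd h (hac.not_twoS S), fun _ => Or.inl ⟨?_, Or.inl ?_⟩⟩
        · change f.bag.ncard = W
          rw [hf.bag_eq, hX]
        · exact hf.bag_eq.symm
      · intro i
        change Fin 2 at i
        revert i
        rw [Fin.forall_fin_two]
        refine ⟨fun h => absurd h (hac.not_bot S), fun _ (h : f.bag.ncard < W) => ?_⟩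
        rw [hf.bag_eq] at h
        omega
      · intro _ i _ _ hi
        exact absurd ((hblocks i).bag_eq.trans_subset (hZX i)) hi
      · intro i
        change Fin 2 at i
        revert i
        rw [Fin.forall_fin_two]
        refine ⟨fun j h => absurd h (hac.not_bot_child S j), fun j _ (h : f.bag.ncard < W) => ?_⟩
        rw [hf.bag_eq] at h
        omega
      · intro i
        change Fin 2 at i
        revert i
        rw [Fin.forall_fin_two]
        refine ⟨fun _ (h : a.bag = X) => absurd h (by rw [ha.bag_eq]; exact hne),
          fun _ _ => ⟨htwo, hf2⟩⟩
      · intro i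
        change Fin 2 at i
        revert i
        rw [Fin.forall_fin_two]
        refine ⟨fun (h : a.bag.ncard = W) => ?_, fun _ h => absurd hf.bag_eq h⟩
        rw [ha.bag_eq] at h
        omega
    have hblock := isBlock_node hblocks hZX hXA hadjX hadj hlocal
    refine ⟨node X 2 ![a, f], ?_, Or.inl ⟨(1 : Fin 2), hf.bag_eq⟩, htwo, ?_⟩
    · have : ⋃ i, (![A, ⋃₀ (𝒜 \ {A})] : Fin 2 → Set V) i = ⋃₀ 𝒜 := by
        ext v
        simp only [Set.mem_iUnion, Fin.exists_fin_two, Set.mem_sUnion, Matrix.cons_val_zero,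
          Matrix.cons_val_one, Matrix.cons_val_fin_one]
        constructor
        · rintro (h | ⟨B, hB, h⟩)
          · exact ⟨A, hA, h⟩
          · exact ⟨B, hB.1, h⟩
        · rintro ⟨B, hB, h⟩
          by_cases hBA : B = A
          · exact Or.inl (hBA ▸ h)
          · exact Or.inr ⟨B, ⟨hB, hBA⟩, h⟩
      rw [← this]
      exact hblock
    · intro B hB hBS
      by_cases hBA : B = A
      · subst hBA
        refine ⟨a.verts, .here (node X 2 ![a, f]) (0 : Fin 2) (hSC 0) ?_, ?_, ?_⟩
        · change a.bag ≠ X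
          rw [ha.bag_eq]; exact hne
        · rw [ha.verts_eq]; exact Set.subset_union_right
        · rw [ha.verts_eq]; exact Set.union_subset_union_left _ Set.sdiff_subset
      · obtain ⟨P, hP, h1, h2⟩ := hfparts B ⟨hB, hBA⟩ hBS
        exact ⟨P, .there (node X 2 ![a, f]) (1 : Fin 2) P hf.bag_eq hP, h1, h2⟩

theorem fullPiece_of_ncard_le_two [Finite V] {X : Set V} {𝒜 : Set (Set V)} (hX : X.ncard = W)
    (h : Attachable G S W X 𝒜) (h2 : {A ∈ 𝒜 | (A ∩ S).Nonempty}.ncard ≤ 2) :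
    FullPiece G S W X (⋃₀ 𝒜) := by
  obtain ⟨t, h3, h4, -, -⟩ := exists_isBlock_of_ncard_le_two hX h h2
  refine ⟨t, h3, Or.inr h4, ?_⟩
  rintro ⟨j, hj⟩
  have := (h4 j).1
  rw [hj] at this
  omega

/-- Everything outside of the subtree lies in the single part above the root, which is why at most
one of the three components may be missing from `𝒜`. Parts below are distinct because each lies in
`X` together with its own component. -/
theorem fullPiece_of_three_parts [Finite V] {X : Set V} {𝒜 : Set (Set V)} (hX : X.ncard = W)
    (h : Attachable G S W X 𝒜) (h2 : 2 ≤ {A ∈ 𝒜 | (A ∩ S).Nonempty}.ncard)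
    (h3 : ∀ v ∈ X \ S, ∃ C : Fin 3 → Set V, (∀ i j, i ≠ j → Disjoint (C i) (C j)) ∧
      (∀ i, IsComp G X (C i) ∧ (C i ∩ S).Nonempty ∧ (∃ u ∈ C i, G.Adj v u) ∧
        (C i ∈ 𝒜 ∨ Disjoint (C i) (X ∪ ⋃₀ 𝒜))) ∧
      ∀ i j, C i ∉ 𝒜 → C j ∉ 𝒜 → i = j) :
    FullPiece G S W X (⋃₀ 𝒜) := by
  obtain ⟨t, ht, hj, -, hparts⟩ := exists_isBlock_join hX h h2
  refine ⟨t, ht, hj, fun _ v hv => ?_⟩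
  rw [ht.bag_eq] at hv ⊢
  obtain ⟨C, hdisj, hC, hout⟩ := h3 v hv
  have hP : ∀ i, ∃ P, C i ⊆ P ∧ ((C i ∈ 𝒜 ∧ IsPartSet S X t P ∧ P ⊆ X ∪ C i) ∨
      (C i ∉ 𝒜 ∧ P = t.vertsᶜ)) := by
    intro i
    obtain ⟨-, h5, -, h7⟩ := hC i
    by_cases hi : C i ∈ 𝒜
    · obtain ⟨P, h8, h9, h10⟩ := hparts _ hi h5
      exact ⟨P, h9, Or.inl ⟨hi, h8, h10⟩⟩
    · refine ⟨t.vertsᶜ, ?_, Or.inr ⟨hi, rfl⟩⟩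
      rw [ht.verts_eq]
      exact (h7.resolve_left hi).subset_compl_right
  choose P hCP hP using hP
  have hverts : ∀ i, C i ∈ 𝒜 → C i ⊆ t.verts := fun i hi => by
    rw [ht.verts_eq]
    exact (Set.subset_sUnion_of_mem hi).trans Set.subset_union_right
  refine ⟨C, P, fun i j hij => ?_, hdisj, fun i => ?_⟩
  · by_contra hne
    obtain ⟨u, hu⟩ := (hC i).1.conn.1
    obtain ⟨w, hw⟩ := (hC j).1.conn.1
    rcases hP i with ⟨h1, h2, h3⟩ | ⟨h1, h2⟩ <;> rcases hP j with ⟨h4, h5, h6⟩ | ⟨h4, h5⟩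
    · rcases h6 (hij ▸ hCP i hu) with h7 | h7
      · exact (hC i).1.disj.notMem_of_mem_left hu h7
      · exact (hdisj i j hne).notMem_of_mem_left hu h7
    · have := hCP i hu
      rw [hij, h5] at this
      exact this (hverts i h1 hu)
    · have := hCP j hw
      rw [← hij, h2] at this
      exact this (hverts j h4 hw)
    · exact hne (hout i j h1 h4)
  · refine ⟨(hC i).1, (hC i).2.1, (hC i).2.2.1, hCP i, ?_⟩
    rcases hP i with ⟨h1, h2, h3⟩ | ⟨h1, h2⟩
    · exact Or.inl h2
    · exact Or.inr h2

end BagTree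

/-! ### Existence and disjointness of components -/

section Components

variable {V : Type*} {G : SimpleGraph V}

theorem connSet_singleton (x : V) : ConnSet G {x} :=
  ⟨Set.singleton_nonempty x, fun _ hB hne _ => (Set.subset_singleton_iff_eq.1 hB).resolve_left
    hne.ne_empty⟩

theorem ConnSet.insert_of_adj {C : Set V} (hC : ConnSet G C) {u v : V} (hu : u ∈ C)
    (huv : G.Adj u v) : ConnSet G (insert v C) := by
  refine ⟨Set.insert_nonempty v C, fun B hB hne hcl => ?_⟩
  by_cases hBC : (B ∩ C).Nonempty
  · have h1 := hC.2 (B ∩ C) Set.inter_subset_right hBC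
      fun b hb c hc hbc => ⟨hcl b hb.1 c (Or.inr hc) hbc, hc⟩
    have h2 : C ⊆ B := fun c hc => (h1.symm ▸ hc : c ∈ B ∩ C).1
    exact subset_antisymm hB (Set.insert_subset (hcl u (h2 hu) v (Or.inl rfl) huv) h2)
  · exfalso
    obtain ⟨b, hb⟩ := hne
    have hbv : b = v := (hB hb).resolve_right fun h => hBC ⟨b, hb, h⟩
    exact hBC ⟨u, hcl b hb u (Or.inr hu) (hbv ▸ huv.symm), hu⟩

theorem ConnSet.subset_of_closed {C B : Set V} (hC : ConnSet G C) (hne : (C ∩ B).Nonempty)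
    (hcl : ∀ b ∈ B, ∀ c ∈ C, G.Adj b c → c ∈ B) : C ⊆ B := by
  have := hC.2 (C ∩ B) Set.inter_subset_left hne fun b hb c hc hbc => ⟨hc, hcl b hb.2 c hc hbc⟩
  exact Set.inter_eq_left.1 this

theorem ConnSet.subset_of_isComp {X C E : Set V} (hC : ConnSet G C) (hCX : Disjoint C X)
    (hE : IsComp G X E) (hne : (C ∩ E).Nonempty) : C ⊆ E :=
  hC.subset_of_closed hne fun _ hb _ hc hbc => hE.mem_of_adj hb (hCX.notMem_of_mem_left hc) hbc

theorem IsComp.eq_of_inter_nonempty {X E E' : Set V} (hE : IsComp G X E) (hE' : IsComp G X E')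
    (hne : (E ∩ E').Nonempty) : E = E' :=
  subset_antisymm (hE.conn.subset_of_isComp hE.disj hE' hne)
    (hE'.conn.subset_of_isComp hE'.disj hE (by rwa [Set.inter_comm]))

theorem IsComp.disjoint {X E E' : Set V} (hE : IsComp G X E) (hE' : IsComp G X E')
    (hne : E ≠ E') : Disjoint E E' := by
  rw [Set.disjoint_iff_inter_eq_empty, ← Set.not_nonempty_iff_eq_empty]
  exact fun h => hne (hE.eq_of_inter_nonempty hE' h)

/-- The component is the union of all connected sets that avoid `X` and contain a fixed point of
`C`. -/
theorem exists_isComp_of_connSet {X C : Set V} (hC : ConnSet G C) (hCX : Disjoint C X) :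
    ∃ E, IsComp G X E ∧ C ⊆ E := by
  obtain ⟨x, hx⟩ := hC.1
  let 𝒞 : Set (Set V) := {D | ConnSet G D ∧ Disjoint D X ∧ x ∈ D}
  refine ⟨⋃₀ 𝒞, ⟨⟨⟨x, C, ⟨hC, hCX, hx⟩, hx⟩, ?_⟩, ?_, ?_⟩, Set.subset_sUnion_of_mem ⟨hC, hCX, hx⟩⟩
  · rintro B hB ⟨b, hb⟩ hcl
    have key : ∀ D ∈ 𝒞, (D ∩ B).Nonempty → D ⊆ B := fun D hD hne =>
      hD.1.subset_of_closed hne fun b hb c hc hbc => hcl b hb c ⟨D, hD, hc⟩ hbc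
    obtain ⟨D, hD, hbD⟩ := hB hb
    have hxB := key D hD ⟨b, hbD, hb⟩ hD.2.2
    exact subset_antisymm hB (Set.sUnion_subset fun D' hD' => key D' hD' ⟨x, hD'.2.2, hxB⟩)
  · exact Set.disjoint_sUnion_left.2 fun D hD => hD.2.1
  · rintro v ⟨hv, u, ⟨D, hD, hu⟩, huv⟩
    by_contra hvX
    refine hv ⟨insert v D, ⟨hD.1.insert_of_adj hu huv, ?_, Or.inr hD.2.2⟩, Or.inl rfl⟩
    exact Set.disjoint_insert_left.2 ⟨hvX, hD.2.1⟩

theorem exists_isComp_of_notMem {X : Set V} {x : V} (hx : x ∉ X) :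
    ∃ E, IsComp G X E ∧ x ∈ E := by
  obtain ⟨E, hE, h⟩ := exists_isComp_of_connSet (G := G) (connSet_singleton x)
    (Set.disjoint_singleton_left.2 hx)
  exact ⟨E, hE, h rfl⟩

theorem IsComp.subset_of_inter_nonempty {X R E : Set V} (hE : IsComp G X E)
    (hR : outerNbhd G R ⊆ X) (hne : (E ∩ R).Nonempty) : E ⊆ R :=
  hE.conn.subset_of_closed hne fun b hb c hc hbc => by
    by_contra hcR
    exact hE.disj.notMem_of_mem_left hc (hR ⟨hcR, b, hb, hbc⟩)

end Components

/-! ### Assembling the components below one bag -/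

namespace BagTree

variable {V : Type*} {G : SimpleGraph V} {S : Set V} {W : ℕ}

theorem nonAdj_of_isComp {X E E' : Set V} (hE : IsComp G X E) (hE' : IsComp G X E')
    (hne : E ≠ E') : NonAdj G E E' := fun _ ha _ hb hab =>
  (hE.disjoint hE' hne).notMem_of_mem_left
    (hE.mem_of_adj ha (hE'.disj.notMem_of_mem_left hb) hab) hb

theorem piece_sUnion [Finite V] {Z : Set V} (hZ : Z.ncard < W) (𝒜 : Set (Set V))
    (h : ∀ A ∈ 𝒜, Piece G S W Z A) (hdisj : ∀ A ∈ 𝒜, ∀ B ∈ 𝒜, A ≠ B → Disjoint A B)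
    (hadj : ∀ A ∈ 𝒜, ∀ B ∈ 𝒜, A ≠ B → NonAdj G A B) : Piece G S W Z (⋃₀ 𝒜) := by
  induction 𝒜, 𝒜.toFinite using Set.Finite.induction_on with
  | empty => rw [Set.sUnion_empty]; exact piece_empty hZ
  | @insert A 𝒜 hA _ ih =>
    rw [Set.sUnion_insert]
    have hne : ∀ B ∈ 𝒜, A ≠ B := fun B hB h => hA (h ▸ hB)
    refine piece_union (h A (Or.inl rfl)) (ih (fun B hB => h B (Or.inr hB))
      (fun B hB C hC => hdisj B (Or.inr hB) C (Or.inr hC))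
      (fun B hB C hC => hadj B (Or.inr hB) C (Or.inr hC))) ?_ ?_
    · exact Set.disjoint_sUnion_right.2 fun B hB => hdisj A (Or.inl rfl) B (Or.inr hB) (hne B hB)
    · rintro a ha b ⟨B, hB, hb⟩
      exact hadj A (Or.inl rfl) B (Or.inr hB) (hne B hB) a ha b hb

/-- Combines pieces for the components of `G - X` inside `R` into a piece for `R ∪ X \ Z`. -/
theorem piece_assemble [Finite V] {X R Z : Set V} (hX : X.ncard ≤ W) (hZX : Z ⊆ X)
    (hZ : Z.ncard < W) (hXR : Disjoint X R) (hR : outerNbhd G R ⊆ X)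
    (hE : ∀ E, IsComp G X E → E ⊆ R → Piece G S W (outerNbhd G E) E)
    (hseen : (R ∩ S).Nonempty → ∀ v ∈ Z \ S, ∃ E, ConnSet G E ∧ Disjoint E (X ∪ R) ∧
      (E ∩ S).Nonempty ∧ ∃ u ∈ E, G.Adj v u) : Piece G S W Z (R ∪ X \ Z) := by
  let 𝒜 : Set (Set V) := {E | IsComp G X E ∧ E ⊆ R}
  have hdisj : ∀ A ∈ 𝒜, ∀ B ∈ 𝒜, A ≠ B → Disjoint A B := fun A hA B hB => hA.1.disjoint hB.1
  have hadj : ∀ A ∈ 𝒜, ∀ B ∈ 𝒜, A ≠ B → NonAdj G A B := fun A hA B hB =>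
    nonAdj_of_isComp hA.1 hB.1
  have hU : ⋃₀ 𝒜 = R := by
    apply subset_antisymm (Set.sUnion_subset fun E hE => hE.2)
    intro x hx
    obtain ⟨E, hE, hxE⟩ := exists_isComp_of_notMem (G := G) (hXR.notMem_of_mem_right hx)
    exact ⟨E, ⟨hE, hE.subset_of_inter_nonempty hR ⟨x, hxE, hx⟩⟩, hxE⟩
  have hraise : ∀ E ∈ 𝒜, ∀ Y ⊆ X, outerNbhd G E ⊆ Y → Y.ncard < W → Piece G S W Y E := by
    intro E hEA Y hYX hNY hY
    refine (hE E hEA.1 hEA.2).mono_bag hNY hY (hEA.1.disj.symm.mono_left hYX) ?_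
    exact fun a ha _ hb hab => hb.2 ⟨hEA.1.disj.notMem_of_mem_right (hYX hb.1), a, ha, hab⟩
  -- If `X` is smaller than `W`, all components are joined at the bag `X` itself.
  rcases hX.lt_or_eq with hX | hX
  · have := piece_sUnion hX 𝒜 (fun E hEA => hraise E hEA X subset_rfl hEA.1.nbhd hX) hdisj hadj
    rw [hU] at this
    exact this.anti_bag hZX
  have hfinal : ∀ w ∈ X, w ∉ Z → Piece G S W (X \ {w}) (R ∪ {w}) → Piece G S W Z (R ∪ X \ Z) := by
    intro w hwX hwZ h
    have hsub : Z ⊆ X \ {w} := fun z hz => ⟨hZX hz, fun h => hwZ (Set.mem_singleton_iff.1 h ▸ hz)⟩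
    have h2 := h.anti_bag hsub
    have : R ∪ {w} ∪ (X \ {w}) \ Z = R ∪ X \ Z := by
      ext v
      simp only [Set.mem_union, Set.mem_singleton_iff, Set.mem_sdiff]
      by_cases hv : v = w
      · subst hv; tauto
      · tauto
    rwa [this] at h2
  obtain ⟨w₀, hw₀X, hw₀Z⟩ : ∃ w ∈ X, w ∉ Z := by
    by_contra! hcon
    have := Set.ncard_le_ncard (show X ⊆ Z from hcon) Z.toFinite
    omega
  -- The neighborhood of a component is the bag of a piece, hence smaller than `X`, so some `w ∈ X`
  -- is not adjacent to the component.
  have hattach : Attachable G S W X 𝒜 := by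
    refine ⟨fun E hEA => ⟨hEA.1.disj.symm, ?_⟩, hdisj, hadj⟩
    have hlt := (hE E hEA.1 hEA.2).ncard_lt
    obtain ⟨w, hwX, hwN⟩ : ∃ w ∈ X, w ∉ outerNbhd G E := by
      by_contra! hcon
      have := Set.ncard_le_ncard (show X ⊆ outerNbhd G E from hcon) (Set.toFinite _)
      omega
    have hcard := Set.ncard_sdiff_singleton_of_mem hwX
    have hpos := (Set.ncard_pos X.toFinite).2 ⟨w, hwX⟩
    refine ⟨w, hwX, hraise E hEA _ Set.sdiff_subset
      (fun v hv => ⟨hEA.1.nbhd hv, fun h => hwN (Set.mem_singleton_iff.1 h ▸ hv)⟩) (by omega), ?_⟩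
    rintro a ha b rfl hab
    exact hwN ⟨hEA.1.disj.notMem_of_mem_right hwX, a, ha, hab⟩
  have hdone : FullPiece G S W X R → Piece G S W Z (R ∪ X \ Z) := fun h =>
    hfinal w₀ hw₀X hw₀Z (h.piece hX hw₀X)
  by_cases h2 : {A ∈ 𝒜 | (A ∩ S).Nonempty}.ncard ≤ 2
  · exact hdone (hU ▸ fullPiece_of_ncard_le_two hX hattach h2)
  by_cases h3 : ∀ v ∈ X \ S, ∃ C : Fin 3 → Set V, (∀ i j, i ≠ j → Disjoint (C i) (C j)) ∧
      (∀ i, IsComp G X (C i) ∧ (C i ∩ S).Nonempty ∧ (∃ u ∈ C i, G.Adj v u) ∧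
        (C i ∈ 𝒜 ∨ Disjoint (C i) (X ∪ ⋃₀ 𝒜))) ∧
      ∀ i j, C i ∉ 𝒜 → C j ∉ 𝒜 → i = j
  · exact hdone (hU ▸ fullPiece_of_three_parts hX hattach (by omega) h3)
  push Not at h2
  obtain ⟨v, hv, hbad⟩ : ∃ v ∈ X \ S, ¬ ∃ C : Fin 3 → Set V,
      (∀ i j, i ≠ j → Disjoint (C i) (C j)) ∧
      (∀ i, IsComp G X (C i) ∧ (C i ∩ S).Nonempty ∧ (∃ u ∈ C i, G.Adj v u) ∧
        (C i ∈ 𝒜 ∨ Disjoint (C i) (X ∪ ⋃₀ 𝒜))) ∧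
      ∀ i j, C i ∉ 𝒜 → C j ∉ 𝒜 → i = j := by
    by_contra hcon
    exact h3 fun v hv => by
      by_contra h
      exact hcon ⟨v, hv, h⟩
  -- For the vertex `v` that lacks three parts, the $S$-components not seeing it fit together over
  -- `X \ {v}`, which is not full; those seeing it form `𝒮`.
  let ℬ : Set (Set V) := {E ∈ 𝒜 | (E ∩ S).Nonempty ∧ v ∉ outerNbhd G E}
  have hℬ : ℬ ⊆ 𝒜 := fun E hE => hE.1
  let 𝒮 : Set (Set V) := {E ∈ 𝒜 | (E ∩ S).Nonempty ∧ v ∈ outerNbhd G E}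
  have hseeing : ∀ E ∈ 𝒮, IsComp G X E ∧ (E ∩ S).Nonempty ∧ (∃ u ∈ E, G.Adj v u) ∧
      (E ∈ 𝒜 ∨ Disjoint E (X ∪ ⋃₀ 𝒜)) := by
    rintro E ⟨hEA, hES, -, u, huE, huv⟩
    exact ⟨hEA.1, hES, ⟨u, huE, huv.symm⟩, Or.inl hEA⟩
  have hcard := Set.ncard_sdiff_singleton_of_mem hv.1
  have hpos := (Set.ncard_pos X.toFinite).2 ⟨v, hv.1⟩
  have hpieceℬ : Piece G S W (X \ {v}) (⋃₀ ℬ) := by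
    refine piece_sUnion (by omega) ℬ (fun E hEB => hraise E hEB.1 _ Set.sdiff_subset ?_ (by omega))
      (fun A hA B hB => hdisj A (hℬ hA) B (hℬ hB)) (fun A hA B hB => hadj A (hℬ hA) B (hℬ hB))
    exact fun x hx => ⟨hEB.1.1.nbhd hx, fun h => hEB.2.2 (Set.mem_singleton_iff.1 h ▸ hx)⟩
  have hnonadj : NonAdj G (⋃₀ ℬ) {v} := by
    rintro a ⟨E, hE, ha⟩ b rfl hab
    exact hE.2.2 ⟨hE.1.1.disj.notMem_of_mem_right hv.1, a, ha, hab⟩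
  have hdisjℬ : ∀ A ∈ 𝒜 \ ℬ, Disjoint A (⋃₀ ℬ) := fun A hA =>
    Set.disjoint_sUnion_right.2 fun B hB => hdisj A hA.1 B (hℬ hB) fun h => hA.2 (h ▸ hB)
  have hadjℬ : ∀ A ∈ 𝒜 \ ℬ, NonAdj G A (⋃₀ ℬ) := by
    rintro A hA a ha b ⟨B, hB, hb⟩
    exact hadj A hA.1 B (hℬ hB) (fun h => hA.2 (h ▸ hB)) a ha b hb
  have hcover : ⋃₀ (𝒜 \ ℬ) ∪ ⋃₀ ℬ = R := by
    rw [← Set.sUnion_union, Set.sdiff_union_of_subset hℬ, hU]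
  have hmem𝒮 : ∀ A ∈ 𝒜 \ ℬ, (A ∩ S).Nonempty → A ∈ 𝒮 := fun A hA hAS =>
    ⟨hA.1, hAS, by_contra fun h => hA.2 ⟨hA.1, hAS, h⟩⟩
  by_cases hvZ : v ∈ Z
  -- Here `v` is in the bag above and `hseen` supplies an $S$-component outside of `R` that sees
  -- `v`. Two more inside would contradict the choice of `v`.
  · have h𝒮 : 𝒮.ncard ≤ 1 := by
      by_contra hcon
      obtain ⟨A, hA, B, hB, hAB⟩ := (Set.one_lt_ncard 𝒮.toFinite).1 (not_le.1 hcon)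
      have hRS : (R ∩ S).Nonempty := by
        obtain ⟨u, hu, huS⟩ := hA.2.1
        exact ⟨u, hA.1.2 hu, huS⟩
      obtain ⟨E, hEconn, hEdisj, hES, u, huE, hvu⟩ := hseen hRS v ⟨hvZ, hv.2⟩
      obtain ⟨C, hC, hEC⟩ := exists_isComp_of_connSet hEconn
        (hEdisj.mono_right Set.subset_union_left)
      have hCR : Disjoint C R := by
        rw [Set.disjoint_iff_inter_eq_empty, ← Set.not_nonempty_iff_eq_empty]
        intro hne
        exact hEdisj.notMem_of_mem_left huE
          (Or.inr (hC.subset_of_inter_nonempty hR hne (hEC huE)))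
      have hCA : C ∉ 𝒜 := fun h => hCR.notMem_of_mem_left (hEC huE) (h.2 (hEC huE))
      have hAC : A ≠ C := fun h => hCA (h ▸ hA.1)
      have hBC : B ≠ C := fun h => hCA (h ▸ hB.1)
      have h1 := hdisj A hA.1 B hB.1 hAB
      have h4 := hA.1.1.disjoint hC hAC
      have h5 := hB.1.1.disjoint hC hBC
      refine hbad ⟨![A, B, C], ?_, ?_, ?_⟩
      · intro i j hij
        fin_cases i <;> fin_cases j <;> first | exact absurd rfl hij | skip
        exacts [h1, h4, h1.symm, h5, h4.symm, h5.symm]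
      · intro i
        fin_cases i
        · exact hseeing A hA
        · exact hseeing B hB
        · refine ⟨hC, hES.mono (Set.inter_subset_inter_left _ hEC), ⟨u, hEC huE, hvu⟩, Or.inr ?_⟩
          rw [hU]
          exact Set.disjoint_union_right.2 ⟨hC.disj, hCR⟩
      · intro i j hi hj
        fin_cases i <;> fin_cases j <;>
          first | rfl | exact absurd hA.1 hi | exact absurd hB.1 hi | exact absurd hA.1 hj |
            exact absurd hB.1 hj
    -- The union of `ℬ` is attached to `X` as one set, so together with `𝒮` at most two $S$-children
    -- arise.
    have hfull : FullPiece G S W X (⋃₀ (insert (⋃₀ ℬ) (𝒜 \ ℬ))) := by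
      refine fullPiece_of_ncard_le_two hX ⟨?_, ?_, ?_⟩ ?_
      · rintro A (rfl | hA)
        · exact ⟨Set.disjoint_sUnion_right.2 fun B hB => hB.1.1.disj.symm, v, hv.1, hpieceℬ, hnonadj⟩
        · exact hattach.attach A hA.1
      · rintro A (rfl | hA) B (rfl | hB) hAB
        · exact absurd rfl hAB
        · exact (hdisjℬ B hB).symm
        · exact hdisjℬ A hA
        · exact hdisj A hA.1 B hB.1 hAB
      · rintro A (rfl | hA) B (rfl | hB) hAB
        · exact absurd rfl hAB
        · exact (hadjℬ B hB).symm
        · exact hadjℬ A hA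
        · exact hadj A hA.1 B hB.1 hAB
      · have hsub : {A ∈ insert (⋃₀ ℬ) (𝒜 \ ℬ) | (A ∩ S).Nonempty} ⊆ insert (⋃₀ ℬ) 𝒮 := by
          rintro A ⟨rfl | hA, hAS⟩
          · exact Or.inl rfl
          · exact Or.inr (hmem𝒮 A hA hAS)
        have h1 := Set.ncard_le_ncard hsub (Set.toFinite _)
        have h4 := Set.ncard_insert_le (⋃₀ ℬ) 𝒮
        omega
    rw [Set.sUnion_insert, Set.union_comm, hcover] at hfull
    exact hdone hfull
  · have h𝒮 : 𝒮.ncard ≤ 2 := by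
      by_contra hcon
      obtain ⟨A, B, C, hA, hB, hC, hAB, hAC, hBC⟩ :=
        (Set.two_lt_ncard_iff 𝒮.toFinite).1 (not_le.1 hcon)
      have h1 := hdisj A hA.1 B hB.1 hAB
      have h4 := hdisj A hA.1 C hC.1 hAC
      have h5 := hdisj B hB.1 C hC.1 hBC
      refine hbad ⟨![A, B, C], ?_, ?_, ?_⟩
      · intro i j hij
        fin_cases i <;> fin_cases j <;> first | exact absurd rfl hij | skip
        exacts [h1, h4, h1.symm, h5, h4.symm, h5.symm]
      · intro i
        fin_cases i
        exacts [hseeing A hA, hseeing B hB, hseeing C hC]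
      · intro i j hi _
        fin_cases i
        exacts [absurd hA.1 hi, absurd hB.1 hi, absurd hC.1 hi]
    -- Since `v` may be forgotten, `ℬ` is kept away from `X`: it is joined only after the step from
    -- `X` up to `X \ {v}`.
    have hfull : FullPiece G S W X (⋃₀ (𝒜 \ ℬ)) := by
      refine fullPiece_of_ncard_le_two hX (hattach.mono Set.sdiff_subset) ?_
      refine (Set.ncard_le_ncard ?_ 𝒮.toFinite).trans h𝒮
      exact fun A hA => hmem𝒮 A hA.1 hA.2
    have hp := piece_union (hfull.piece hX hv.1) hpieceℬ
      (Set.disjoint_union_left.2 ⟨Set.disjoint_sUnion_left.2 hdisjℬ,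
        Set.disjoint_sUnion_right.2 fun B hB =>
          Set.disjoint_singleton_left.2 (hB.1.1.disj.notMem_of_mem_right hv.1)⟩)
      (by
        rintro a (⟨A, hA, ha⟩ | ha) b hb
        · exact hadjℬ A hA a ha b hb
        · exact hnonadj.symm a ha b hb)
    rw [Set.union_right_comm, hcover] at hp
    exact hfinal v hv.1 hvZ hp

end BagTree

/-! ### Bag families -/

/-- A family of vertex sets that behaves like the subsets of the bags of a tree decomposition of
width less than `W`. -/
structure IsBagFamily {V : Type*} (G : SimpleGraph V) (W : ℕ) (F : Set (Set V)) : Prop where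
  empty_mem : ∅ ∈ F
  mem_of_subset : ∀ X ∈ F, ∀ Y ⊆ X, Y ∈ F
  ncard_le : ∀ X ∈ F, X.ncard ≤ W
  exists_insert : ∀ Z ∈ F, ∀ D, ConnSet G D → Disjoint D Z → Z ⊆ outerNbhd G D →
    ∃ d ∈ D, insert d Z ∈ F

/-! ### Separators towards `S` and hulls -/

section Hull

variable {V : Type*} {G : SimpleGraph V} {S : Set V}

/-- The vertices of the neighborhood of `C` that lie in `S` or are attached to `S` from outside
of `C`. -/
def sSeparator (G : SimpleGraph V) (S C : Set V) : Set V :=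
  {v ∈ outerNbhd G C | v ∈ S ∨ ∃ E, ConnSet G E ∧ Disjoint E (C ∪ outerNbhd G C) ∧
    (E ∩ S).Nonempty ∧ ∃ u ∈ E, G.Adj v u}

/-- `D` is the component containing `C` after removing the `S`-separator of `C`. -/
def IsHull (G : SimpleGraph V) (S C D : Set V) : Prop := IsComp G (sSeparator G S C) D ∧ C ⊆ D

theorem sSeparator_subset (C : Set V) : sSeparator G S C ⊆ outerNbhd G C := fun _ h => h.1

theorem disjoint_outerNbhd (C : Set V) : Disjoint C (outerNbhd G C) :=
  Set.disjoint_right.2 fun _ h => h.1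

theorem exists_isHull {C : Set V} (hC : ConnSet G C) : ∃ D, IsHull G S C D :=
  exists_isComp_of_connSet hC ((disjoint_outerNbhd C).mono_right (sSeparator_subset C))

theorem IsHull.outerNbhd_eq {C D : Set V} (h : IsHull G S C D) :
    outerNbhd G D = sSeparator G S C := by
  refine subset_antisymm h.1.nbhd fun z hz => ?_
  obtain ⟨c, hc, hcz⟩ := hz.1.2
  exact ⟨h.1.disj.notMem_of_mem_right hz, c, h.2 hc, hcz⟩

/-- Let `Q` be the union of all such sets `E`. No edge inside `D` enters `Q` from outside: from `C`
it would end in `N(C)`, from `N(C)` it would start in the separator, and otherwise its start could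
be added to `E`. As `D` is connected and contains `C`, it misses `Q`. -/
theorem IsHull.disjoint {C D E : Set V} (h : IsHull G S C D) (hE : ConnSet G E)
    (hEC : Disjoint E (C ∪ outerNbhd G C)) (hES : (E ∩ S).Nonempty) (hC : C.Nonempty) :
    Disjoint E D := by
  let Q : Set V := {x | ∃ E, ConnSet G E ∧ Disjoint E (C ∪ outerNbhd G C) ∧
    (E ∩ S).Nonempty ∧ x ∈ E}
  have key : D ⊆ D ∩ Qᶜ := by
    apply h.1.conn.subset_of_closed
    · obtain ⟨c, hc⟩ := hC
      refine ⟨c, h.2 hc, h.2 hc, ?_⟩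
      rintro ⟨E, -, hE, -, hcE⟩
      exact hE.notMem_of_mem_left hcE (Or.inl hc)
    · rintro b ⟨hbD, hbQ⟩ c hc hbc
      refine ⟨hc, ?_⟩
      rintro ⟨E, hE, hEC, hES, hcE⟩
      have hcC := hEC.notMem_of_mem_left hcE
      have hbC : b ∉ C := fun hb => hcC (Or.inr ⟨fun h => hcC (Or.inl h), b, hb, hbc⟩)
      by_cases hbN : b ∈ outerNbhd G C
      · exact h.1.disj.notMem_of_mem_left hbD ⟨hbN, Or.inr ⟨E, hE, hEC, hES, c, hcE, hbc⟩⟩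
      · refine hbQ ⟨insert b E, hE.insert_of_adj hcE hbc.symm, ?_,
          hES.mono (Set.inter_subset_inter_left _ (Set.subset_insert b E)), Or.inl rfl⟩
        exact Set.disjoint_insert_left.2 ⟨fun h => h.elim hbC hbN, hEC⟩
  exact Set.disjoint_left.2 fun x hxE hxD => (key hxD).2 ⟨E, hE, hEC, hES, hxE⟩

/-- A vertex of `S` in `D` outside of `C` would either belong to the separator or be, as a
singleton, a connected set excluded by `IsHull.disjoint`. -/
theorem IsHull.inter_subset {C D : Set V} (h : IsHull G S C D) (hC : C.Nonempty) :
    D ∩ S ⊆ C := by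
  rintro s ⟨hsD, hsS⟩
  by_contra hsC
  have hsN : s ∉ outerNbhd G C := fun hsN =>
    h.1.disj.notMem_of_mem_left hsD ⟨hsN, Or.inl hsS⟩
  exact (h.disjoint (connSet_singleton s)
    (Set.disjoint_singleton_left.2 fun h => h.elim hsC hsN) ⟨s, rfl, hsS⟩ hC).notMem_of_mem_left
    rfl hsD

theorem IsHull.notMem_of_adj {C D E : Set V} {v : V} (h : IsHull G S C D) (hE : ConnSet G E)
    (hEC : Disjoint E (C ∪ outerNbhd G C)) (hES : (E ∩ S).Nonempty) (hC : C.Nonempty)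
    (hv : v ∉ C) (hadj : ∃ u ∈ E, G.Adj v u) : v ∉ D := by
  intro hvD
  by_cases hvN : v ∈ outerNbhd G C
  · exact h.1.disj.notMem_of_mem_left hvD ⟨hvN, Or.inr ⟨E, hE, hEC, hES, hadj⟩⟩
  · obtain ⟨u, hu, hvu⟩ := hadj
    exact (h.disjoint (hE.insert_of_adj hu hvu.symm)
      (Set.disjoint_insert_left.2 ⟨fun h => h.elim hv hvN, hEC⟩)
      (hES.mono (Set.inter_subset_inter_left _ (Set.subset_insert v E))) hC).notMem_of_mem_left
      (Or.inl rfl) hvD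

theorem outerNbhd_sdiff_singleton_subset (C : Set V) (d : V) :
    outerNbhd G (C \ {d}) ⊆ insert d (outerNbhd G C) := by
  rintro v ⟨hv, u, hu, huv⟩
  by_cases hvC : v ∈ C
  · exact Or.inl (by_contra fun h => hv ⟨hvC, h⟩)
  · exact Or.inr ⟨hvC, u, hu.1, huv⟩

end Hull

/-! ### The recursion over connected sets -/

namespace BagTree

variable {V : Type*} [Finite V] {G : SimpleGraph V} {S : Set V} {W : ℕ} {F : Set (Set V)}

theorem ncard_lt_of_insert_mem (hF : IsBagFamily G W F) {Z : Set V} {d : V} (hd : d ∉ Z)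
    (h : insert d Z ∈ F) : Z.ncard < W := by
  have h1 := hF.ncard_le _ h
  rw [Set.ncard_insert_of_notMem hd Z.toFinite] at h1
  omega

/-- Plain recursion with bag `N(D) ∪ {d}`. Without vertices of `S` below, no condition on what the
bag sees outside is needed. -/
theorem piece_of_disjoint (hF : IsBagFamily G W F) {D : Set V} (hD : ConnSet G D)
    (hDS : Disjoint D S) (hN : outerNbhd G D ∈ F) : Piece G S W (outerNbhd G D) D := by
  induction hn : D.ncard using Nat.strong_induction_on generalizing D with
  | h n ih =>
    obtain ⟨d, hd, hdF⟩ := hF.exists_insert _ hN D hD (disjoint_outerNbhd D) subset_rfl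
    have hdN : d ∉ outerNbhd G D := fun h => h.1 hd
    have h := piece_assemble (G := G) (S := S) (W := W) (X := insert d (outerNbhd G D))
      (R := D \ {d}) (Z := outerNbhd G D) (hF.ncard_le _ hdF) (Set.subset_insert _ _)
      (ncard_lt_of_insert_mem hF hdN hdF)
      (Set.disjoint_insert_left.2 ⟨fun h => h.2 rfl,
        (disjoint_outerNbhd D).symm.mono_right Set.sdiff_subset⟩)
      (outerNbhd_sdiff_singleton_subset D d)
      (fun E hE hED => ih E.ncard (hn ▸ Set.ncard_lt_ncard
          (hED.trans_ssubset (Set.sdiff_singleton_ssubset.2 hd)) D.toFinite) hE.conn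
        (hDS.mono_left (hED.trans Set.sdiff_subset)) (hF.mem_of_subset _ hdF _ hE.nbhd) rfl)
      (fun ⟨s, hs, hsS⟩ => absurd hsS (hDS.notMem_of_mem_left hs.1))
    have heq : D \ {d} ∪ insert d (outerNbhd G D) \ outerNbhd G D = D := by
      ext v
      have : v ∈ D → v ∉ outerNbhd G D := fun hv h => h.1 hv
      simp only [Set.mem_union, Set.mem_sdiff, Set.mem_singleton_iff, Set.mem_insert_iff]
      by_cases hvd : v = d
      · subst hvd; tauto
      · tauto
    rwa [heq] at h

/-- Passing to the hull guarantees that every separator vertex outside of `S` sees `S` from outside,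
which `piece_assemble` demands. The induction is on `C`, not on its hull: the components considered
next lie in `C \ {d}`. -/
theorem piece_of_isHull (hF : IsBagFamily G W F) {C D : Set V} (hC : ConnSet G C)
    (hCS : (C ∩ S).Nonempty) (hN : outerNbhd G C ∈ F) (hD : IsHull G S C D) :
    Piece G S W (sSeparator G S C) D := by
  induction hn : C.ncard using Nat.strong_induction_on generalizing C D with
  | h n ih =>
    obtain ⟨d, hd, hX⟩ := hF.exists_insert _ hN C hC (disjoint_outerNbhd C) subset_rfl
    have hdN : d ∉ outerNbhd G C := fun h => h.1 hd
    set X := insert d (outerNbhd G C) with hXdef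
    have hXsub : X ⊆ C ∪ outerNbhd G C :=
      Set.insert_subset (Or.inl hd) Set.subset_union_right
    let 𝒞 : Set (Set V) := {C' | IsComp G X C' ∧ C' ⊆ C ∧ (C' ∩ S).Nonempty}
    let ℋ : Set (Set V) := {D' | ∃ C' ∈ 𝒞, IsHull G S C' D'}
    have h𝒞 : ∀ C' ∈ 𝒞, C' ∪ outerNbhd G C' ⊆ C ∪ outerNbhd G C := fun C' hC' =>
      Set.union_subset (hC'.2.1.trans Set.subset_union_left) (hC'.1.nbhd.trans hXsub)
    have hZD : ∀ D' ∈ ℋ, Disjoint (sSeparator G S C) D' := by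
      rintro D' ⟨C', hC', hD'⟩
      rw [Set.disjoint_left]
      intro z hz hzD'
      have hzC' : z ∉ C' := fun h => hz.1.1 (hC'.2.1 h)
      rcases hz.2 with hzS | ⟨E, hE, hEC, hES, hadj⟩
      · exact hzC' (hD'.inter_subset hC'.1.conn.1 ⟨hzD', hzS⟩)
      · exact hD'.notMem_of_adj hE (hEC.mono_right (h𝒞 C' hC')) hES hC'.1.conn.1 hzC' hadj hzD'
    have hDD : ∀ D' ∈ ℋ, D' ⊆ D := by
      rintro D' ⟨C', hC', hD'⟩
      obtain ⟨c, hc⟩ := hC'.1.conn.1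
      exact hD'.1.conn.subset_of_isComp (hZD D' ⟨C', hC', hD'⟩).symm hD.1
        ⟨c, hD'.2 hc, hD.2 (hC'.2.1 hc)⟩
    -- A separator vertex of `C₁` sees `C₁`, which meets `S` and lies away from any other `C₂`; so
    -- the hull of `C₂` cannot contain it.
    have hsep : ∀ C₁ ∈ 𝒞, ∀ D₂ ∈ ℋ, Disjoint (sSeparator G S C₁) D₂ := by
      rintro C₁ hC₁ D₂ ⟨C₂, hC₂, hD₂⟩
      by_cases hne : C₁ = C₂
      · subst hne
        exact hD₂.1.disj.symm
      rw [Set.disjoint_left]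
      intro v hv
      have hvX : v ∈ X := hC₁.1.nbhd hv.1
      refine hD₂.notMem_of_adj hC₁.1.conn ?_ hC₁.2.2 hC₂.1.conn.1
        (hC₂.1.disj.notMem_of_mem_right hvX) ?_
      · exact Set.disjoint_union_right.2 ⟨hC₁.1.disjoint hC₂.1 hne,
          hC₁.1.disj.mono_right hC₂.1.nbhd⟩
      · obtain ⟨c, hc, hcv⟩ := hv.1.2
        exact ⟨c, hc, hcv.symm⟩
    -- Vertices of `X` swallowed by a hull are dropped from the bag. What remains contains all
    -- separators involved, so each hull is a component of `G - Y`.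
    set Y := X \ ⋃₀ ℋ with hYdef
    have hYX : Y ⊆ X := Set.sdiff_subset
    have hZY : sSeparator G S C ⊆ Y := fun z hz =>
      ⟨Or.inr hz.1, fun ⟨D', hD', hzD'⟩ => (hZD D' hD').notMem_of_mem_left hz hzD'⟩
    have hcomp : ∀ C' ∈ 𝒞, ∀ D', IsHull G S C' D' → IsComp G Y D' := by
      intro C' hC' D' hD'
      refine ⟨hD'.1.conn, ?_, ?_⟩
      · exact Set.disjoint_right.2 fun v hv hvD' => hv.2 ⟨D', ⟨C', hC', hD'⟩, hvD'⟩
      · rw [hD'.outerNbhd_eq]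
        exact fun v hv => ⟨hC'.1.nbhd hv.1, fun ⟨D₂, hD₂, hvD₂⟩ =>
          (hsep C' hC' D₂ hD₂).notMem_of_mem_left hv hvD₂⟩
    have h := piece_assemble (G := G) (S := S) (W := W) (X := Y) (R := D \ Y)
      (Z := sSeparator G S C) (hF.ncard_le _ (hF.mem_of_subset _ hX _ hYX)) hZY
      ((Set.ncard_le_ncard (sSeparator_subset C) (Set.toFinite _)).trans_lt
        (ncard_lt_of_insert_mem hF hdN hX))
      Set.disjoint_sdiff_right
      (by
        rintro v ⟨hv, u, hu, huv⟩
        by_cases hvD : v ∈ D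
        · by_contra hvY
          exact hv ⟨hvD, hvY⟩
        · exact hZY (hD.1.nbhd ⟨hvD, u, hu.1, huv⟩))
      (by
        intro E hE hED
        by_cases hES : (E ∩ S).Nonempty
        -- A component meeting `S` is one of the hulls. Its vertex `s` lies in `C`, as hulls add
        -- nothing from `S`, and not in `X`, as otherwise `s` would have been swallowed by a hull,
        -- for the same reason impossible.
        · obtain ⟨s, hsE, hsS⟩ := hES
          have hsC : s ∈ C := hD.inter_subset hC.1 ⟨(hED hsE).1, hsS⟩
          have hsX : s ∉ X := by
            intro hsX
            apply (hED hsE).2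
            refine ⟨hsX, ?_⟩
            rintro ⟨D', ⟨C', hC', hD'⟩, hsD'⟩
            exact hC'.1.disj.notMem_of_mem_right hsX
              (hD'.inter_subset hC'.1.conn.1 ⟨hsD', hsS⟩)
          obtain ⟨C', hC', hsC'⟩ := exists_isComp_of_notMem (G := G) hsX
          have hC'C : C' ⊆ C \ {d} := hC'.subset_of_inter_nonempty
            (outerNbhd_sdiff_singleton_subset C d)
            ⟨s, hsC', hsC, fun h => hsX (Or.inl (Set.mem_singleton_iff.1 h))⟩
          have hmem : C' ∈ 𝒞 := ⟨hC', hC'C.trans Set.sdiff_subset, s, hsC', hsS⟩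
          obtain ⟨D', hD'⟩ := exists_isHull (S := S) hC'.conn
          have hED' : E = D' := hE.eq_of_inter_nonempty (hcomp C' hmem D' hD')
            ⟨s, hsE, hD'.2 hsC'⟩
          rw [hED', hD'.outerNbhd_eq]
          exact ih C'.ncard (hn ▸ Set.ncard_lt_ncard
            (hC'C.trans_ssubset (Set.sdiff_singleton_ssubset.2 hd)) C.toFinite) hC'.conn
            ⟨s, hsC', hsS⟩ (hF.mem_of_subset _ hX _ hC'.nbhd) hD' rfl
        · refine piece_of_disjoint hF hE.conn ?_ (hF.mem_of_subset _ hX _ (hE.nbhd.trans hYX))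
          rw [Set.disjoint_iff_inter_eq_empty, ← Set.not_nonempty_iff_eq_empty]
          exact hES)
      (by
        rintro - v ⟨hv, hvS⟩
        obtain ⟨E, hE, hEC, hES, hadj⟩ := hv.2.resolve_left hvS
        refine ⟨E, hE, Set.disjoint_union_right.2 ⟨hEC.mono_right (hYX.trans hXsub), ?_⟩, hES, hadj⟩
        exact (hD.disjoint hE hEC hES hC.1).mono_right Set.sdiff_subset)
    have heq : D \ Y ∪ Y \ sSeparator G S C = D := by
      have hsub : Y \ sSeparator G S C ⊆ D := by
        rintro x ⟨hxY, hxZ⟩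
        rcases hYX hxY with rfl | hx
        · exact hD.2 hd
        · obtain ⟨c, hc, hcx⟩ := hx.2
          exact hD.1.mem_of_adj (hD.2 hc) hxZ hcx
      ext x
      have h1 := @hsub x
      have h2 : x ∈ D → x ∉ sSeparator G S C := fun h => hD.1.disj.notMem_of_mem_left h
      simp only [Set.mem_union, Set.mem_sdiff] at h1 ⊢
      tauto
    rwa [heq] at h

theorem piece_univ (hF : IsBagFamily G W F) (hW : 0 < W) : Piece G S W ∅ Set.univ := by
  have h := piece_assemble (G := G) (S := S) (W := W) (X := ∅) (R := Set.univ) (Z := ∅)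
    (by simp) subset_rfl (by simpa using hW) (Set.empty_disjoint _)
    (fun v hv => absurd (Set.mem_univ v) hv.1)
    (by
      intro E hE _
      have hN : outerNbhd G E = ∅ := Set.subset_empty_iff.1 hE.nbhd
      have hNF : outerNbhd G E ∈ F := hN ▸ hF.empty_mem
      by_cases hES : (E ∩ S).Nonempty
      · have hsep : sSeparator G S E = ∅ :=
          Set.subset_empty_iff.1 ((sSeparator_subset E).trans hE.nbhd)
        rw [hN, ← hsep]
        exact piece_of_isHull hF hE.conn hES hNF ⟨hsep.symm ▸ hE, subset_rfl⟩
      · refine piece_of_disjoint hF hE.conn ?_ hNF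
        rw [Set.disjoint_iff_inter_eq_empty, ← Set.not_nonempty_iff_eq_empty]
        exact hES)
    (fun _ v hv => absurd hv.1 (Set.notMem_empty v))
  simpa using h

end BagTree

/-! ### Bags of a tree decomposition form a bag family -/

namespace RootedTreeDecomposition

variable {V ι : Type*} {G : SimpleGraph V}

theorem reachable_deleteEdges_of_mem_bag (T : RootedTreeDecomposition G ι) {v : V} {t t' x y : ι}
    (h : v ∉ T.bag t ∨ v ∉ T.bag t') (hx : v ∈ T.bag x) (hy : v ∈ T.bag y) :
    (T.tree.deleteEdges {s(t, t')}).Reachable x y := by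
  let f : T.tree.induce {z | v ∈ T.bag z} →g T.tree.deleteEdges {s(t, t')} :=
    { toFun := Subtype.val
      map_rel' := by
        rintro ⟨a, ha⟩ ⟨b, hb⟩ hab
        rw [SimpleGraph.deleteEdges_adj]
        refine ⟨hab, fun heq => ?_⟩
        rcases Sym2.eq_iff.1 (Set.mem_singleton_iff.1 heq) with ⟨rfl, rfl⟩ | ⟨rfl, rfl⟩
        · exact h.elim (fun h => h ha) fun h => h hb
        · exact h.elim (fun h => h hb) fun h => h ha }
  exact ((T.connected_bag v).preconnected ⟨x, hx⟩ ⟨y, hy⟩).map f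

/-- Choose a node `t` with `Z` in its bag as close as possible to a node `s` whose bag meets `D`. If
the bag of `t` missed `D`, all bags meeting `D` would lie beyond the first edge `t t'` towards `s`.
Each vertex of `Z` has a neighbor in `D`, so it occurs beyond that edge too and is in the bag of
`t'`, which is closer. -/
theorem exists_insert_subset_bag (T : RootedTreeDecomposition G ι) {Z D : Set V}
    (hZ : ∃ t, Z ⊆ T.bag t) (hD : ConnSet G D) (hZD : Z ⊆ outerNbhd G D) :
    ∃ d ∈ D, ∃ t, insert d Z ⊆ T.bag t := by
  have hcover : ∀ v, ∃ t, v ∈ T.bag t := fun v => by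
    have : v ∈ ⋃ t, T.bag t := T.iUnion_bag ▸ Set.mem_univ v
    simpa using this
  have hex : ∃ n, ∃ t s, Z ⊆ T.bag t ∧ (D ∩ T.bag s).Nonempty ∧ T.tree.dist t s = n := by
    obtain ⟨t, ht⟩ := hZ
    obtain ⟨d, hd⟩ := hD.1
    obtain ⟨s, hs⟩ := hcover d
    exact ⟨_, t, s, ht, ⟨d, hd, hs⟩, rfl⟩
  classical
  obtain ⟨t, s, ht, ⟨d, hdD, hds⟩, hdist⟩ := Nat.find_spec hex
  have hmin : ∀ t s, Z ⊆ T.bag t → (D ∩ T.bag s).Nonempty → Nat.find hex ≤ T.tree.dist t s :=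
    fun t s h1 h2 => Nat.find_min' hex ⟨t, s, h1, h2, rfl⟩
  by_cases htD : (D ∩ T.bag t).Nonempty
  · obtain ⟨d, hd, hdt⟩ := htD
    exact ⟨d, hd, t, Set.insert_subset hdt ht⟩
  exfalso
  obtain ⟨w, hw⟩ := T.isTree.connected.exists_walk_length_eq_dist t s
  cases w with
  | nil => exact htD ⟨d, hdD, hds⟩
  | @cons _ t' _ hadj w =>
    rw [SimpleGraph.Walk.length_cons] at hw
    have hbridge := (SimpleGraph.isAcyclic_iff_forall_adj_isBridge.1 T.isTree.isAcyclic) hadj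
    rw [SimpleGraph.isBridge_iff] at hbridge
    have htD' : ∀ c ∈ D, c ∉ T.bag t := fun c hc hct => htD ⟨c, hc, hct⟩
    have hreach : ∀ c ∈ D, ∀ x, c ∈ T.bag x →
        (T.tree.deleteEdges {s(t, t')}).Reachable s x := by
      have := hD.2 {c ∈ D | ∀ x, c ∈ T.bag x → (T.tree.deleteEdges {s(t, t')}).Reachable s x}
        (fun c hc => hc.1)
        ⟨d, hdD, fun x hx => T.reachable_deleteEdges_of_mem_bag (Or.inl (htD' d hdD)) hds hx⟩
        (by
          rintro b ⟨hb, hbx⟩ c hc hbc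
          obtain ⟨y, hby, hcy⟩ := T.exists_bag_of_adj b c hbc
          exact ⟨hc, fun x hx => (hbx y hby).trans
            (T.reachable_deleteEdges_of_mem_bag (Or.inl (htD' c hc)) hcy hx)⟩)
      intro c hc
      rw [← this] at hc
      exact hc.2
    have hts : (T.tree.deleteEdges {s(t, t')}).Reachable t' s := by
      refine ⟨w.toDeleteEdges {s(t, t')} ?_⟩
      rintro e he heq
      rw [Set.mem_singleton_iff] at heq
      subst heq
      have htw := w.fst_mem_support_of_mem_edges he
      have h1 := SimpleGraph.dist_le (w.dropUntil t htw)
      have h2 := w.length_dropUntil_le_length htw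
      omega
    have hle := hmin t' s (fun z hz => ?_) ⟨d, hdD, hds⟩
    · have := SimpleGraph.dist_le w
      omega
    · by_contra hzt'
      obtain ⟨-, c, hc, hcz⟩ := hZD hz
      obtain ⟨q, hcq, hzq⟩ := T.exists_bag_of_adj c z hcz
      exact hbridge (((T.reachable_deleteEdges_of_mem_bag (Or.inr hzt') (ht hz) hzq).trans
        (hreach c hc q hcq).symm).trans hts.symm)

theorem isBagFamily [Finite ι] (T : RootedTreeDecomposition G ι) [Finite V] :
    IsBagFamily G (⨆ t, (T.bag t).ncard) {X | ∃ t, X ⊆ T.bag t} where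
  empty_mem := ⟨T.root, Set.empty_subset _⟩
  mem_of_subset := fun _ ⟨t, ht⟩ _ hY => ⟨t, hY.trans ht⟩
  ncard_le := fun _ ⟨t, ht⟩ => (Set.ncard_le_ncard ht (Set.toFinite _)).trans
    (le_ciSup (f := fun t => (T.bag t).ncard) (Set.finite_range _).bddAbove t)
  exists_insert := fun _ hZ _ hD _ hZD => T.exists_insert_subset_bag hZ hD hZD

end RootedTreeDecomposition

/-! ### The minimal bag size and the conclusion -/

namespace BagTree

/-- For the smallest possible bag size there is a tree of bags that satisfies the local
conditions. -/
theorem exists_slimLocal {V : Type*} [Finite V] {G : SimpleGraph V} (S : Set V) {W : ℕ}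
    {F : Set (Set V)} (hF : IsBagFamily G W F) :
    ∃ t : BagTree V, All (SlimLocal G S W) t ∧ t.verts = Set.univ ∧
      (∀ u v, G.Adj u v → InSomeBag u v t) ∧
      (∀ i, t.bag.ncard = W → (t.child i).bag ≠ t.bag) ∧ ¬ Bot S t := by
  -- Pieces need a bag smaller than `W`, so `W = 0` is separate; inserting a vertex into `∅` shows
  -- that then there are no vertices.
  rcases Nat.eq_zero_or_pos W with rfl | hW
  · have hV : IsEmpty V := by
      constructor
      intro x
      obtain ⟨d, -, hd⟩ := hF.exists_insert ∅ hF.empty_mem {x} (connSet_singleton x)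
        (Set.disjoint_empty _) (Set.empty_subset _)
      have := hF.ncard_le _ hd
      simp at this
    refine ⟨node ∅ 0 Fin.elim0, ?_, Set.eq_univ_of_univ_subset fun x => isEmptyElim x,
      fun u => isEmptyElim u, fun i => i.elim0, fun h => isEmptyElim h.1.some⟩
    exact (all_iff _ _).2 ⟨slimLocal_of_calm (fun i => i.elim0)
      ⟨fun i => i.elim0, fun i => i.elim0⟩ (by simp) (fun i => i.elim0)
      (Or.inl fun i => i.elim0), fun i => i.elim0⟩
  · obtain ⟨t, ht, hc⟩ := piece_univ (S := S) hF hW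
    have hv : t.verts = Set.univ := by rw [ht.verts_eq, Set.empty_union]
    exact ⟨t, ht.slim, hv, fun u v h => ht.covers u (by simp [hv]) v (by simp [hv]) h,
      fun i h => absurd hc.1 (by omega), hc.not_bot S⟩

end BagTree

theorem mainTheorem5 {V ι : Type*} [Finite V] [Finite ι] (G : SimpleGraph V) (S : Set V)
    (T : RootedTreeDecomposition G ι) (hT : T.IsSNice S) (k : ℤ) (hk : T.width = k) :
    ∃ (κ : Type) (_ : Finite κ) (T' : RootedTreeDecomposition G κ),
      T'.IsSNice S ∧ T'.IsSlim S ∧ T'.width ≤ k ∧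
      ∀ F, T'.IsFullJoinTree F → ∀ X : Set V, (∀ t ∈ F, T'.bag t = X) →
        ∀ r, T'.IsRootOf F r → ∀ v ∈ X \ S,
          ∃ (C : Fin 3 → (G.induce Xᶜ).ConnectedComponent) (t : Fin 3 → κ),
            Function.Injective C ∧ Function.Injective t ∧
            ∀ i, IsSComponent S (C i) ∧ (∃ u ∈ componentVerts (C i), G.Adj v u) ∧
              ∃ P : Set V, T'.IsPart S F r (t i) P ∧ componentVerts (C i) ⊆ P := by
  classical
  -- The bound is minimized instead of being read off from `T`: fullness refers to the width of the
  -- new decomposition, which must therefore be known exactly.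
  have hex : ∃ W F, IsBagFamily G W F := ⟨_, _, T.isBagFamily⟩
  obtain ⟨F, hF⟩ := Nat.find_spec hex
  obtain ⟨t, hs, hv, he, hroot, hbot⟩ := BagTree.exists_slimLocal S hF
  have hvalid := BagTree.All.mono (fun _ h => BagTree.SlimLocal.valid h) t hs
  have hne : Nonempty t.Nodes := ⟨t.rootNode⟩
  have hW : (BagTree.toDecomposition hvalid hv he).width = Nat.find hex - 1 := by
    have h1 : (⨆ x, ((BagTree.toDecomposition hvalid hv he).bag x).ncard) ≤ Nat.find hex :=
      ciSup_le fun x => (hs.subAt x).card_le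
    -- The bags just constructed form a bag family as well, so by minimality some bag attains the
    -- bound.
    have h2 := Nat.find_min' hex ⟨_, (BagTree.toDecomposition hvalid hv he).isBagFamily⟩
    unfold RootedTreeDecomposition.width
    omega
  refine ⟨t.Nodes, inferInstance, BagTree.toDecomposition hvalid hv he,
    BagTree.toDecomposition_isSNice hvalid hv he hs,
    BagTree.toDecomposition_isSlim hvalid hv he hs hW hroot hbot, ?_, ?_⟩
  · have h2 := Nat.find_min' hex ⟨_, T.isBagFamily⟩
    rw [hW, ← hk]
    unfold RootedTreeDecomposition.width
    omega
  · exact fun F hF X hX r hr v hvX =>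
      BagTree.exists_three_components hvalid hv he hs hW hroot hF hX hr hvX
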